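/- **Setting.** An episodic tabular POMDP with finite state, action and observation spaces of cardinalities $S,A,O$ and horizon $H\ge 1$ has parameters $\theta=(\mu_1,\{\mathbb T_{h,a}\}_{h\in[H-1]},\{\mathbb O_h\}_{h\in[H]})$: an initial state distribution $\mu_1$, transition matrices $\mathbb T_{h,a}$ (with $\mathbb T_{h,a}(\cdot\mid s)$ the distribution of the next state) and $O\times S$ emission matrices $\mathbb O_h$ (with $\mathbb O_h(\cdot\mid s)$ the distribution of the observation in state $s$). Let $\Theta$ be the set of all such parameters. At step $h$ the agent observes $o_h\sim\mathbb O_h(\cdot\mid s_h)$, receives the reward $r_h(o_h)$, where $r_h$ is a known function with values in $[0,1]$, and takes an action $a_h$; the state then moves according to $\mathbb T_{h,a_h}(\cdot\mid s_h)$. A policy $\pi$ chooses $a_h$ at random, with a distribution depending on $(o_1,a_1,\dots,o_{h-1},a_{h-1},o_h)$. Write $\mathbb P^\pi_\theta(\tau)$ for the probability of the observation-action trajectory $\tau=(o_1,a_1,\dots,o_H,a_H)$, $V^\pi(\theta)=\mathbb E^\pi_\theta\big[\sum_{h=1}^H r_h(o_h)\big]$ and $V^\star(\theta)=\sup_\pi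 V^\pi(\theta)$. For $\alpha>0$, $\theta$ is *$\alpha$-weakly revealing* if $\min_{h\in[H]}\sigma_S(\mathbb O_h)\ge\alpha$, where $\sigma_S$ is the $S$-th largest singular value ($0$ if $S>O$). **Algorithm (OMLE).** Given $\alpha$ and $\beta$, for $k=1,\dots,K$: let $$\mathcal B^k=\Big\{\theta\in\Theta:\ \min_h\sigma_S(\mathbb O_h)\ge\alpha,\ \ \sum_{i<k}\log\mathbb P^{\pi^i}_{\theta}(\tau^i)\ \ge\ \sup_{\theta'\in\Theta}\sum_{i<k}\log\mathbb P^{\pi^i}_{\theta'}(\tau^i)-\beta\Big\}\qquad(\log 0=-\infty),$$ choose, as a deterministic function of the past data $(\pi^i,\tau^i)_{i<k}$, a pair $(\theta^k,\pi^k)\in\operatorname{argmax}_{\theta\in\mathcal B^k,\ \pi}V^\pi(\theta)$ (ties are broken arbitrarily; the choice is arbitrary if $\mathcal B^k=\emptyset$), execute $\pi^k$ in the true POMDP for one episode, and record the trajectory $\tau^k$. **Theorem.** There are an absolute constant $c>0$ and fixed polynomials $p$ and $q$ such that the following holds for every POMDP as above with true parameter $\theta^\star$, every $\alpha>0$ for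 which $\theta^\star$ is $\alpha$-weakly revealing, every $\delta\in(0,1]$ and every integer $K\ge1$. Run OMLE for $K$ episodes with $$\beta=c\big(H(S^2A+SO)\log(SAOHK)+\log(K/\delta)\big).$$ 1. With probability at least $1-\delta$, for all $k\in[K]$, $$\mathrm{Regret}(k)=\sum_{i=1}^k\big(V^\star(\theta^\star)-V^{\pi^i}(\theta^\star)\big)\ \le\ p\big(S,A,O,H,1/\alpha,\log(K/\delta)\big)\,\sqrt k .$$ 2. For every $\varepsilon>0$, if $K\ge q\big(S,A,O,H,1/\alpha,\log(1/\delta),1/\varepsilon\big)$, then with probability at least $1-\delta$ the uniform mixture $\bar\pi$ of $\pi^1,\dots,\pi^K$ (draw one of them uniformly at random before the episode and follow it, written as a single history-dependent policy) is $\varepsilon$-optimal: $V^{\bar\pi}(\theta^\star)\ge V^\star(\theta^\star)-\varepsilon$. -/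

import Mathlib

open scoped ENNReal

noncomputable section

namespace POMDP

/-- A length-`n` observation-action sequence `(o₁, a₁, …, oₙ, aₙ)`. Steps are indexed from `0`:
the index `h : Fin n` stands for step `h + 1`. -/
abbrev Traj (n : ℕ) (𝒪 𝒜 : Type*) : Type _ := Fin n → 𝒪 × 𝒜

/-- The first `m` steps of a trajectory. -/
def Traj.pre {𝒪 𝒜 : Type*} {n : ℕ} (τ : Traj n 𝒪 𝒜) (m : ℕ) (hm : m ≤ n) : Traj m 𝒪 𝒜 :=
  fun i => τ (Fin.castLE hm i)

/-- The parameters `θ = (μ₁, 𝕋, 𝕆)` of an episodic POMDP with horizon `H`; the whole type is the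
parameter space `Θ`. `trans h a s' s` is the probability of moving from `s` to `s'` under action `a`
at step `h` (there are `H - 1` transitions), and `emis h o s` is the probability of observing `o` in
state `s` at step `h`, so that `emis h` is the `O × S` emission matrix. -/
@[ext]
structure Params (H : ℕ) (𝒮 𝒜 𝒪 : Type*) [Fintype 𝒮] [Fintype 𝒪] where
  init : 𝒮 → ℝ
  trans : Fin (H - 1) → 𝒜 → Matrix 𝒮 𝒮 ℝ
  emis : Fin H → Matrix 𝒪 𝒮 ℝ
  init_mem : init ∈ stdSimplex ℝ 𝒮
  trans_mem : ∀ h a s, (fun s' => trans h a s' s) ∈ stdSimplex ℝ 𝒮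
  emis_mem : ∀ h s, (fun o => emis h o s) ∈ stdSimplex ℝ 𝒪

/-- A (randomized, history-dependent) policy: `act h hist o a` is the probability of taking action
`a` at step `h` after the past `hist` of observations and actions and the current observation `o`. -/
@[ext]
structure Policy (H : ℕ) (𝒜 𝒪 : Type*) [Fintype 𝒜] where
  act : (h : Fin H) → Traj h 𝒪 𝒜 → 𝒪 → 𝒜 → ℝ
  act_mem : ∀ h hist o, act h hist o ∈ stdSimplex ℝ 𝒜

variable {H : ℕ} {𝒮 𝒜 𝒪 : Type*}

section Model

variable [Fintype 𝒮] [Fintype 𝒜] [Fintype 𝒪]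

/-- `π(τₙ) = ∏ₕ π(aₕ ∣ τₕ₋₁, oₕ)`, the part of the probability of `τₙ` due to the policy. -/
def Policy.weight (π : Policy H 𝒜 𝒪) {n : ℕ} (hn : n ≤ H) (τ : Traj n 𝒪 𝒜) : ℝ :=
  ∏ h : Fin n, π.act (Fin.castLE hn h) (τ.pre h h.isLt.le) (τ h).1 (τ h).2

/-- `ℙ^π_θ(τ)` for a full trajectory `τ = (o₁, a₁, …, o_H, a_H)`: the sum over all latent state
sequences of the probability of the states, observations and actions. -/
def trajProb [NeZero H] (θ : Params H 𝒮 𝒜 𝒪) (π : Policy H 𝒜 𝒪) (τ : Traj H 𝒪 𝒜) : ℝ :=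
  π.weight le_rfl τ *
    ∑ s : Fin H → 𝒮, θ.init (s 0) * (∏ h : Fin H, θ.emis h (τ h).1 (s h)) *
      ∏ h : Fin (H - 1), θ.trans h (τ ⟨h, by omega⟩).2 (s ⟨h + 1, by omega⟩) (s ⟨h, by omega⟩)

theorem trajProb_nonneg [NeZero H] (θ : Params H 𝒮 𝒜 𝒪) (π : Policy H 𝒜 𝒪) (τ : Traj H 𝒪 𝒜) :
    0 ≤ trajProb θ π τ := by
  refine mul_nonneg (Finset.prod_nonneg fun h _ => (π.act_mem _ _ _).1 _)
    (Finset.sum_nonneg fun s _ => mul_nonneg (mul_nonneg (θ.init_mem.1 _) ?_) ?_)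
  · exact Finset.prod_nonneg fun h _ => (θ.emis_mem h _).1 _
  · exact Finset.prod_nonneg fun h _ => (θ.trans_mem h _ _).1 _

/-- A product of conditional probability mass functions sums to one. -/
theorem sum_prod_history {X : Type*} [Fintype X] (n : ℕ)
    (f : (h : Fin n) → (Fin h → X) → X → ℝ) (hf : ∀ h hist, ∑ x, f h hist x = 1) :
    ∑ x : Fin n → X, ∏ h : Fin n, f h (fun i => x (Fin.castLE h.isLt.le i)) (x h) = 1 := by
  induction n with
  | zero => simp
  | succ n ih =>
    rw [← (Fin.snocEquiv fun _ : Fin (n + 1) => X).sum_comp, Fintype.sum_prod_type_right]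
    have key : ∀ (y : Fin n → X) (a : X),
        ∏ h : Fin (n + 1), f h (fun i => (Fin.snocEquiv fun _ : Fin (n + 1) => X) (a, y)
          (Fin.castLE h.isLt.le i)) ((Fin.snocEquiv fun _ : Fin (n + 1) => X) (a, y) h) =
        (∏ h : Fin n, f h.castSucc (fun i => y (Fin.castLE h.isLt.le i)) (y h)) *
          f (Fin.last n) y a := by
      intro y a
      rw [Fin.prod_univ_castSucc]
      congr 1
      · refine Finset.prod_congr rfl fun h _ => ?_
        have h1 : (fun i : Fin (h.castSucc : Fin (n + 1)) =>
            (Fin.snocEquiv fun _ : Fin (n + 1) => X) (a, y)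
              (Fin.castLE h.castSucc.isLt.le i)) =
            fun i : Fin h => y (Fin.castLE h.isLt.le i) := by
          funext i
          exact Fin.snoc_castSucc (α := fun _ : Fin (n + 1) => X) a y (Fin.castLE h.isLt.le i)
        have h2 : (Fin.snocEquiv fun _ : Fin (n + 1) => X) (a, y) h.castSucc = y h :=
          Fin.snoc_castSucc (α := fun _ : Fin (n + 1) => X) a y h
        rw [h2]
        exact congrArg (fun g => f h.castSucc g (y h)) h1
      · have h1 : (fun i : Fin (Fin.last n : Fin (n + 1)) =>
            (Fin.snocEquiv fun _ : Fin (n + 1) => X) (a, y)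
              (Fin.castLE (Fin.last n).isLt.le i)) = y := by
          funext i
          exact Fin.snoc_castSucc (α := fun _ : Fin (n + 1) => X) a y i
        have h2 : (Fin.snocEquiv fun _ : Fin (n + 1) => X) (a, y) (Fin.last n) = a :=
          Fin.snoc_last (α := fun _ : Fin (n + 1) => X) a y
        rw [h2]
        exact congrArg (fun g => f (Fin.last n) g a) h1
    simp_rw [key, ← Finset.mul_sum]
    have hl : ∀ y : Fin n → X, ∑ a, f (Fin.last n) y a = 1 := fun y => hf (Fin.last n) y
    simp_rw [hl, mul_one]
    exact ih (fun h => f h.castSucc) fun h hist => hf h.castSucc hist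

theorem sum_trajProb [hH : NeZero H] (θ : Params H 𝒮 𝒜 𝒪) (π : Policy H 𝒜 𝒪) :
    ∑ τ : Traj H 𝒪 𝒜, trajProb θ π τ = 1 := by
  obtain ⟨n, rfl⟩ : ∃ n, H = n + 1 := Nat.exists_eq_succ_of_ne_zero hH.out
  let st : (h : Fin (n + 1)) → (Fin h → (𝒪 × 𝒜) × 𝒮) → 𝒮 → ℝ :=
    Fin.cases (fun _ s => θ.init s)
      (fun j hist s => θ.trans j (hist ⟨j, by simp⟩).1.2 s (hist ⟨j, by simp⟩).2)
  let f : (h : Fin (n + 1)) → (Fin h → (𝒪 × 𝒜) × 𝒮) → (𝒪 × 𝒜) × 𝒮 → ℝ := fun h hist x =>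
    st h hist x.2 * θ.emis h x.1.1 x.2 * π.act h (fun i => (hist i).1) x.1.1 x.1.2
  have hst : ∀ h hist, ∑ s, st h hist s = 1 := by
    intro h
    refine Fin.cases (fun _ => θ.init_mem.2) (fun j hist => (θ.trans_mem j _ _).2) h
  have hf : ∀ h hist, ∑ x, f h hist x = 1 := by
    intro h hist
    rw [Fintype.sum_prod_type_right]
    simp_rw [Fintype.sum_prod_type, f, ← Finset.mul_sum, (π.act_mem h _ _).2, mul_one,
      ← Finset.mul_sum, (θ.emis_mem h _).2, mul_one]
    exact hst h hist
  rw [← sum_prod_history (n + 1) f hf,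
    ← (Equiv.arrowProdEquivProdArrow (Fin (n + 1)) (fun _ => 𝒪 × 𝒜) (fun _ => 𝒮)).symm.sum_comp,
    Fintype.sum_prod_type]
  refine Finset.sum_congr rfl fun τ _ => ?_
  rw [trajProb, Finset.mul_sum]
  refine Finset.sum_congr rfl fun s _ => ?_
  simp only [f, Finset.prod_mul_distrib]
  rw [Fin.prod_univ_succ (fun h => st h _ _)]
  rw [mul_comm (Policy.weight _ _ _)]
  refine congrArg₂ _ ?_ rfl
  rw [mul_right_comm]
  rfl

/-- The law of the trajectory of one episode in the model `θ` under the policy `π`. -/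
def trajLaw [NeZero H] (θ : Params H 𝒮 𝒜 𝒪) (π : Policy H 𝒜 𝒪) : PMF (Traj H 𝒪 𝒜) :=
  PMF.ofFintype (fun τ => ENNReal.ofReal (trajProb θ π τ)) (by
    rw [← ENNReal.ofReal_sum_of_nonneg fun τ _ => trajProb_nonneg θ π τ, sum_trajProb,
      ENNReal.ofReal_one])

/-- The value `V^π(θ)`: the expected total reward of an episode. -/
def value [NeZero H] (r : Fin H → 𝒪 → ℝ) (θ : Params H 𝒮 𝒜 𝒪) (π : Policy H 𝒜 𝒪) : ℝ :=
  ∑ τ : Traj H 𝒪 𝒜, trajProb θ π τ * ∑ h : Fin H, r h (τ h).1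

/-- The optimal value `V^⋆(θ) = sup_π V^π(θ)`. -/
def optValue [NeZero H] (r : Fin H → 𝒪 → ℝ) (θ : Params H 𝒮 𝒜 𝒪) : ℝ :=
  ⨆ π : Policy H 𝒜 𝒪, value r θ π

/-- The `α`-weakly revealing condition `min_h σ_S(𝕆_h) ≥ α`. Singular values are listed in
decreasing order from index `0`, so the `S`-th largest has index `S - 1`. -/
def WeaklyRevealing [DecidableEq 𝒮] (α : ℝ) (θ : Params H 𝒮 𝒜 𝒪) : Prop :=
  ∀ h : Fin H, α ≤ (Matrix.toEuclideanLin (θ.emis h)).singularValues (Fintype.card 𝒮 - 1)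

/-- The data recorded by the learner: the executed policies with the observed trajectories. -/
abbrev Data (H : ℕ) (𝒜 𝒪 : Type*) [Fintype 𝒜] : Type _ :=
  List (Policy H 𝒜 𝒪 × Traj H 𝒪 𝒜)

/-- The log-likelihood `∑_{(π,τ) ∈ D} log ℙ^π_θ(τ)`, with `log 0 = -∞`. -/
def logLik [NeZero H] (θ : Params H 𝒮 𝒜 𝒪) (D : Data H 𝒜 𝒪) : EReal :=
  (D.map fun d => ENNReal.log (ENNReal.ofReal (trajProb θ d.1 d.2))).sum

/-- The confidence set of the algorithm: the `α`-weakly revealing models whose log-likelihood on the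
data is within `β` of the maximal log-likelihood over all models. -/
def confSet [DecidableEq 𝒮] [NeZero H] (α β : ℝ) (D : Data H 𝒜 𝒪) : Set (Params H 𝒮 𝒜 𝒪) :=
  {θ | WeaklyRevealing α θ ∧
    (⨆ θ' : Params H 𝒮 𝒜 𝒪, logLik θ' D) - (β : EReal) ≤ logLik θ D}

/-- `alg`, which maps the data collected so far to a model and the policy to be executed next, is an
implementation of OMLE with parameters `α` and `β`: it returns a maximizer of `V^π(θ)` over all
models `θ` in the confidence set and all policies `π`. (When the confidence set is empty there is no
such pair, and the choice is arbitrary.) -/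
def IsOMLE [DecidableEq 𝒮] [NeZero H] (r : Fin H → 𝒪 → ℝ) (α β : ℝ)
    (alg : Data H 𝒜 𝒪 → Params H 𝒮 𝒜 𝒪 × Policy H 𝒜 𝒪) : Prop :=
  ∀ D : Data H 𝒜 𝒪, (confSet α β D : Set (Params H 𝒮 𝒜 𝒪)).Nonempty →
    (alg D).1 ∈ confSet α β D ∧
      ∀ θ ∈ (confSet α β D : Set (Params H 𝒮 𝒜 𝒪)), ∀ π : Policy H 𝒜 𝒪,
        value r θ π ≤ value r (alg D).1 (alg D).2

/-- The law of the data `(π¹, τ¹), …, (πᴷ, τᴷ)` when `alg` interacts for `K` episodes with the true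
model `θ`: in each episode the policy chosen by `alg` from the past data is executed. -/
def runLaw [NeZero H] (θ : Params H 𝒮 𝒜 𝒪)
    (alg : Data H 𝒜 𝒪 → Params H 𝒮 𝒜 𝒪 × Policy H 𝒜 𝒪) : ℕ → PMF (Data H 𝒜 𝒪)
  | 0 => PMF.pure []
  | k + 1 => (runLaw θ alg k).bind fun D =>
      (trajLaw θ (alg D).2).map fun τ => D ++ [((alg D).2, τ)]

/-- The regret `∑ (V^⋆(θ) - V^{π}(θ))` over the first `k` episodes of the data. -/
def regret [NeZero H] (r : Fin H → 𝒪 → ℝ) (θ : Params H 𝒮 𝒜 𝒪) (k : ℕ) (D : Data H 𝒜 𝒪) : ℝ :=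
  ((D.take k).map fun d => optValue r θ - value r θ d.1).sum

end Model

section Mixture

variable [Fintype 𝒜]

theorem Policy.weight_nonneg (π : Policy H 𝒜 𝒪) {n : ℕ} (hn : n ≤ H) (τ : Traj n 𝒪 𝒜) :
    0 ≤ π.weight hn τ :=
  Finset.prod_nonneg fun _ _ => (π.act_mem _ _ _).1 _

open Classical in
/-- The uniform mixture of a list of policies (draw one of them uniformly at random at the beginning
of the episode and follow it), written as a history-dependent policy: the probability of an action
is the average of those of the listed policies under the posterior weights given the history. On
histories that have probability zero under all of them it plays uniformly at random. -/
def mixture [Nonempty 𝒜] (L : List (Policy H 𝒜 𝒪)) : Policy H 𝒜 𝒪 where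
  act h hist o a :=
    if (L.map fun π => π.weight h.isLt.le hist).sum = 0 then (Fintype.card 𝒜 : ℝ)⁻¹
    else (L.map fun π => π.weight h.isLt.le hist * π.act h hist o a).sum /
      (L.map fun π => π.weight h.isLt.le hist).sum
  act_mem h hist o := by
    constructor
    · intro a
      dsimp only
      split_ifs
      · positivity
      · refine div_nonneg (List.sum_nonneg ?_) (List.sum_nonneg ?_)
        · simp only [List.mem_map]
          rintro _ ⟨π, _, rfl⟩
          exact mul_nonneg (π.weight_nonneg _ _) ((π.act_mem _ _ _).1 _)
        · simp only [List.mem_map]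
          rintro _ ⟨π, _, rfl⟩
          exact π.weight_nonneg _ _
    · by_cases h0 : (L.map fun π => π.weight h.isLt.le hist).sum = 0
      · simp [h0]
      · simp only [h0, if_false]
        rw [← Finset.sum_div, div_eq_one_iff_eq h0]
        clear h0
        induction L with
        | nil => simp
        | cons π L ih =>
          simp only [List.map_cons, List.sum_cons, Finset.sum_add_distrib, ih, ← Finset.mul_sum,
            (π.act_mem h hist o).2, mul_one]

end Mixture

/-- The confidence parameter `β = c (H (S²A + SO) log(SAOHK) + log(K/δ))`. -/
def omleBeta (c : ℝ) (S A O H K : ℕ) (δ : ℝ) : ℝ :=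
  c * ((H : ℝ) * ((S : ℝ) ^ 2 * A + (S : ℝ) * O) * Real.log ((S : ℝ) * A * O * H * K) +
    Real.log ((K : ℝ) / δ))

end POMDP

end

/-!
OMLE is an optimistic algorithm whose confidence sets are superlevel sets of the likelihood, and
its analysis has three ingredients.

*Likelihood.* For fixed models `θ'` and `θ`, with `θ` the true one, the square root of the
likelihood ratio of `θ'` against `θ`, multiplied by the exponential of half the accumulated
squared Hellinger distance, is a supermartingale of mean at most one (`sum_mul_hellingerRatio_le`,
`tsum_runLaw_mul_le`). A union bound over the prefixes of the data and over a finite net of models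
is possible because rounding the parameters up and normalizing dominates every trajectory law up
to a factor `exp (1 / K)`, whatever the policy (`exists_net`). Hence, with probability `1 - δ`,
all confidence sets contain the true model (`lik_le_exp_mul_lik`), and each of their members
predicts the laws of the earlier trajectories with a summed squared `ℓ¹` error of order `β`
(`sum_trajDist_sq_le_of_lik_le`).

*Observability.* For a weakly revealing model the emission matrices have left inverses `P` of norm
at most `√S / α` (`exists_leftInverse_of_singularValues`), so the belief of the model can be
compared with the belief that `P` reconstructs from the predictions of the true model. The error
of a model along a policy telescopes into one-step discrepancies that are linear in the beliefs of
the *true* model (`trajDist_le_sum`); conversely each of them is at most a multiple of the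
observable `ℓ¹` error (`stepErr_le_trajDist`, `emErr_le_trajDist`). No alignment of the latent
states of the two models is needed.

*Pigeonhole.* Being linear in `S`-dimensional beliefs, discrepancies which are small on all the
past policies are small on most of the current ones: `sum_abs_dotProduct_le` replaces the family
of beliefs of each episode by a barycentric spanner, which has `S` elements, and applies the
elliptical potential argument to each element of the spanner. This bounds the summed errors of the
chosen models under the chosen policies by a multiple of `√k` (`sum_trajDist_le`).

By optimism the regret is at most `H` times these summed errors (`regret_le_of_confSet`). The
value of the uniform mixture is the average of the values (`length_mul_value_mixture`), so the
sample complexity bound follows from the regret bound at `k = K`, powers of `log K` being absorbed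
by a root of `K`.
-/

namespace POMDP

open Matrix Finset

set_option linter.unusedSectionVars false

/-! ### Linear algebra: spanners, the elliptical potential and left inverses -/

/-- A finite set containing a multiple of every basis vector has a barycentric spanner: coordinates
in a subfamily of maximal determinant are bounded by one, by Cramer's rule. -/
theorem exists_spanner {ι : Type*} [Fintype ι] [DecidableEq ι] (X : Finset (ι → ℝ)) {η : ℝ}
    (hη : η ≠ 0) (hX : ∀ s, Pi.single s η ∈ X) :
    ∃ v : ι → ι → ℝ, (∀ j, v j ∈ X) ∧
      ∀ x ∈ X, ∃ c : ι → ℝ, (∀ j, |c j| ≤ 1) ∧ x = ∑ j, c j • v j := by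
  let A : (ι → ι → ℝ) → Matrix ι ι ℝ := fun v => (Matrix.of v)ᵀ
  have hv0 : (fun s => Pi.single s η) ∈ Fintype.piFinset fun _ : ι => X := by
    simpa [Fintype.mem_piFinset] using hX
  obtain ⟨v, hv, hmax⟩ := Finset.exists_max_image (Fintype.piFinset fun _ : ι => X)
    (fun v => |(A v).det|) ⟨_, hv0⟩
  have hdet0 : 0 < |(A fun s => Pi.single s η).det| := by
    have : (A fun s => Pi.single s η) = η • (1 : Matrix ι ι ℝ) := by
      ext i j
      simp [A, Matrix.one_apply, Pi.single_apply]
    rw [this, Matrix.det_smul, Matrix.det_one, mul_one]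
    positivity
  have hD : 0 < |(A v).det| := hdet0.trans_le (hmax _ hv0)
  have hD' : (A v).det ≠ 0 := abs_pos.1 hD
  rw [Fintype.mem_piFinset] at hv
  refine ⟨v, hv, fun x hx => ⟨fun j => (A v).cramer x j / (A v).det, fun j => ?_, ?_⟩⟩
  · rw [abs_div, div_le_one hD, Matrix.cramer_apply]
    have h1 : (A v).updateCol j x = A (Function.update v j x) := by
      ext i k
      rw [Matrix.updateCol_apply]
      by_cases hk : k = j
      · subst hk; simp [A]
      · simp [A, hk]
    rw [h1]
    refine hmax _ ?_
    rw [Fintype.mem_piFinset]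
    intro k
    by_cases hk : k = j
    · subst hk; simpa using hx
    · simpa [hk] using hv k
  · have h := Matrix.mulVec_cramer (A v) x
    ext i
    have hi := congrFun h i
    simp only [Matrix.mulVec, dotProduct, Pi.smul_apply, smul_eq_mul, A, Matrix.transpose_apply,
      Matrix.of_apply] at hi
    simp only [Finset.sum_apply, Pi.smul_apply, smul_eq_mul, A]
    rw [eq_comm]
    calc ∑ j, cramer (of v)ᵀ x j / (of v)ᵀ.det * v j i
        = (∑ j, v j i * cramer (of v)ᵀ x j) / (of v)ᵀ.det := by
          rw [Finset.sum_div]; exact Finset.sum_congr rfl fun _ _ => by ring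
      _ = x i := by rw [hi]; exact mul_div_cancel_left₀ _ hD'

theorem sq_dotProduct_le {ι : Type*} [Fintype ι] (w x : ι → ℝ) :
    (w ⬝ᵥ x) ^ 2 ≤ (w ⬝ᵥ w) * (x ⬝ᵥ x) := by
  simpa [dotProduct, pow_two] using Finset.sum_mul_sq_le_sq_mul_sq univ w x

section Potential

/-- The regularized Gram matrix `1 + ∑_{t < n} xₜ xₜᵀ`. -/
def gram {ι : Type*} [DecidableEq ι] (x : ℕ → ι → ℝ) (n : ℕ) : Matrix ι ι ℝ :=
  1 + ∑ t ∈ range n, vecMulVec (x t) (x t)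

theorem gram_succ {ι : Type*} [DecidableEq ι] (x : ℕ → ι → ℝ) (n : ℕ) :
    gram x (n + 1) = gram x n + vecMulVec (x n) (x n) := by
  rw [gram, gram, Finset.sum_range_succ, add_assoc]

variable {ι : Type*} [Fintype ι] [DecidableEq ι]

theorem gram_posDef (x : ℕ → ι → ℝ) (n : ℕ) : (gram x n).PosDef := by
  induction n with
  | zero => simpa [gram] using Matrix.PosDef.one
  | succ n ih =>
    rw [gram_succ]
    refine ih.add_posSemidef ?_
    simpa using Matrix.posSemidef_vecMulVec_self_star (x n)

theorem dotProduct_gram_mulVec (x : ℕ → ι → ℝ) (n : ℕ) (w : ι → ℝ) :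
    w ⬝ᵥ gram x n *ᵥ w = w ⬝ᵥ w + ∑ t ∈ range n, (w ⬝ᵥ x t) ^ 2 := by
  induction n with
  | zero => simp [gram]
  | succ n ih =>
    rw [gram_succ, Matrix.add_mulVec, dotProduct_add, ih, Finset.sum_range_succ, add_assoc,
      Matrix.vecMulVec_mulVec]
    simp [dotProduct_comm (x n) w, pow_two]

theorem det_gram_succ (x : ℕ → ι → ℝ) (n : ℕ) :
    (gram x (n + 1)).det = (gram x n).det * (1 + x n ⬝ᵥ (gram x n)⁻¹ *ᵥ x n) := by
  have hu : IsUnit (gram x n).det := (gram_posDef x n).det_pos.ne'.isUnit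
  rw [gram_succ, vecMulVec_eq Unit, det_add_replicateCol_mul_replicateRow hu]
  congr 1
  rw [det_unique]
  simp [Matrix.mul_apply, replicateRow_apply, replicateCol_apply, dotProduct, Matrix.mulVec,
    Finset.mul_sum, Finset.sum_mul]
  rw [Finset.sum_comm]
  exact Finset.sum_congr rfl fun _ _ => Finset.sum_congr rfl fun _ _ => by ring

/-- The Cauchy–Schwarz inequality for the norms of `Λ` and `Λ⁻¹`: the quadratic polynomial
`t ↦ ⟨w - t Λ⁻¹ x, Λ (w - t Λ⁻¹ x)⟩` is nonnegative, so its discriminant is not positive. -/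
theorem sq_dotProduct_le_of_posDef {Λ : Matrix ι ι ℝ} (hΛ : Λ.PosDef) (w x : ι → ℝ) :
    (w ⬝ᵥ x) ^ 2 ≤ (w ⬝ᵥ Λ *ᵥ w) * (x ⬝ᵥ Λ⁻¹ *ᵥ x) := by
  have hu : IsUnit Λ.det := hΛ.det_pos.ne'.isUnit
  set y := Λ⁻¹ *ᵥ x with hy
  have hΛy : Λ *ᵥ y = x := by
    rw [hy, Matrix.mulVec_mulVec, Matrix.mul_nonsing_inv _ hu, Matrix.one_mulVec]
  have hsymm : y ⬝ᵥ Λ *ᵥ w = w ⬝ᵥ x := by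
    have hT : Λᵀ = Λ := by simpa using hΛ.isHermitian.eq
    rw [Matrix.dotProduct_mulVec, ← Matrix.mulVec_transpose, hT, hΛy, dotProduct_comm]
  have key : ∀ t : ℝ, 0 ≤ (x ⬝ᵥ y) * (t * t) + (-2 * (w ⬝ᵥ x)) * t + w ⬝ᵥ Λ *ᵥ w := by
    intro t
    have h := hΛ.posSemidef.dotProduct_mulVec_nonneg (w - t • y)
    have e : star (w - t • y) ⬝ᵥ Λ *ᵥ (w - t • y) =
        (x ⬝ᵥ y) * (t * t) + (-2 * (w ⬝ᵥ x)) * t + w ⬝ᵥ Λ *ᵥ w := by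
      rw [star_trivial, Matrix.mulVec_sub, Matrix.mulVec_smul, hΛy]
      simp only [sub_dotProduct, dotProduct_sub, smul_dotProduct, dotProduct_smul, smul_eq_mul,
        hsymm, dotProduct_comm y x]
      ring
    rwa [e] at h
  have := discrim_le_zero key
  rw [discrim] at this
  nlinarith

/-- The determinant of the Gram matrix grows polynomially in `n`, by the Leibniz formula. -/
theorem log_det_gram_le (x : ℕ → ι → ℝ) (n : ℕ) (hx : ∀ t s, |x t s| ≤ 1) :
    Real.log (gram x n).det ≤
      (Fintype.card ι : ℝ) ^ 2 + Fintype.card ι * Real.log (1 + n) := by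
  set d := Fintype.card ι
  have hentry : ∀ i j, AbsoluteValue.abs (gram x n i j) ≤ (1 + n : ℝ) := by
    intro i j
    rw [gram, Matrix.add_apply, Matrix.sum_apply]
    refine (abs_add_le _ _).trans (add_le_add ?_ ?_)
    · rw [Matrix.one_apply]; split_ifs <;> simp
    · refine (Finset.abs_sum_le_sum_abs _ _).trans ?_
      calc ∑ t ∈ range n, |vecMulVec (x t) (x t) i j| ≤ ∑ t ∈ range n, (1 : ℝ) := by
            refine Finset.sum_le_sum fun t _ => ?_
            rw [vecMulVec_apply, abs_mul]
            exact mul_le_one₀ (hx t i) (abs_nonneg _) (hx t j)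
        _ = n := by simp
  have h := Matrix.det_le hentry
  have hpos := (gram_posDef x n).det_pos
  have h2 : (gram x n).det ≤ (d : ℝ) ^ d * (1 + n) ^ d := by
    refine (le_abs_self _).trans (h.trans ?_)
    rw [nsmul_eq_mul]
    gcongr
    exact_mod_cast Nat.factorial_le_pow d
  have hn : (0 : ℝ) < 1 + n := by positivity
  rcases Nat.eq_zero_or_pos d with hd | hd
  · rw [hd] at h2 ⊢
    simpa using Real.log_le_log hpos h2
  have hd' : (0 : ℝ) < d := by exact_mod_cast hd
  refine (Real.log_le_log hpos h2).trans ?_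
  rw [Real.log_mul (by positivity) (by positivity), Real.log_pow, Real.log_pow]
  have : Real.log d ≤ d := Real.log_le_self hd'.le
  nlinarith

/-- The elliptical potential bound: if `wₖ` is nearly orthogonal to the preceding `xₜ`, then it is
nearly orthogonal to `xₖ` for most `k`. -/
theorem sum_sq_dotProduct_le (x w : ℕ → ι → ℝ) {n : ℕ} (hn : 0 < n) {B : ℝ}
    (hx : ∀ t s, |x t s| ≤ 1)
    (hx' : ∀ t, x t ⬝ᵥ x t ≤ 1)
    (hB : ∀ k < n, w k ⬝ᵥ w k + ∑ t ∈ range k, (w k ⬝ᵥ x t) ^ 2 ≤ B) :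
    ∑ k ∈ range n, (w k ⬝ᵥ x k) ^ 2 ≤
      2 * B * ((Fintype.card ι : ℝ) ^ 2 + Fintype.card ι * Real.log (1 + n)) := by
  have hww : ∀ k, 0 ≤ w k ⬝ᵥ w k := fun k => by
    simpa using dotProduct_star_self_nonneg (w k)
  have hB0 : 0 ≤ B := by
    refine le_trans ?_ (hB 0 hn)
    simpa using hww 0
  suffices h : ∀ m ≤ n, ∑ k ∈ range m, (w k ⬝ᵥ x k) ^ 2 ≤ 2 * B * Real.log (gram x m).det from
    (h n le_rfl).trans (mul_le_mul_of_nonneg_left (log_det_gram_le x n hx) (by positivity))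
  intro m
  induction m with
  | zero => simp [gram]
  | succ m ih =>
    intro hm
    have hpos := (gram_posDef x m).det_pos
    set u := x m ⬝ᵥ (gram x m)⁻¹ *ᵥ x m with hu
    have hu0 : 0 ≤ u := by
      simpa using (gram_posDef x m).inv.posSemidef.dotProduct_mulVec_nonneg (x m)
    rw [Finset.sum_range_succ, det_gram_succ, Real.log_mul hpos.ne' (by positivity), mul_add]
    refine add_le_add (ih (by omega)) ?_
    have hq := hB m (by omega)
    rw [← dotProduct_gram_mulVec] at hq
    -- Both `B * u` and `B` bound the new term; `min 1 u ≤ 2 u / (1 + u) ≤ 2 log (1 + u)`.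
    have h1 : (w m ⬝ᵥ x m) ^ 2 ≤ B * u :=
      (sq_dotProduct_le_of_posDef (gram_posDef x m) _ _).trans (mul_le_mul_of_nonneg_right hq hu0)
    have h2 : (w m ⬝ᵥ x m) ^ 2 ≤ B := by
      refine (sq_dotProduct_le _ _).trans ?_
      have h3 : w m ⬝ᵥ w m ≤ B := by
        refine le_trans ?_ (hB m (by omega))
        exact le_add_of_nonneg_right (Finset.sum_nonneg fun _ _ => sq_nonneg _)
      exact (mul_le_of_le_one_right (hww m) (hx' m)).trans h3
    have hlog : 1 - (1 + u)⁻¹ ≤ Real.log (1 + u) := Real.one_sub_inv_le_log_of_pos (by positivity)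
    have hfrac : 1 - (1 + u)⁻¹ = u / (1 + u) := by field_simp; ring
    rw [hfrac] at hlog
    have h4 : (w m ⬝ᵥ x m) ^ 2 ≤ 2 * B * (u / (1 + u)) := by
      rw [← mul_div_assoc, le_div_iff₀ (by positivity)]
      nlinarith
    exact h4.trans (mul_le_mul_of_nonneg_left hlog (by positivity))

end Potential

/-- The pigeonhole argument for families of linear measurements: if the functionals `wₖ` have small
total absolute values on all earlier families `(x t j)ⱼ`, the values on the current families have a
sum of order `√n`. Each family is replaced by a barycentric spanner of its signed sums (padded by
small multiples of the basis vectors, so that they span), which makes the scalar potential bound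
applicable. -/
theorem sum_abs_dotProduct_le {ι J : Type*} [Fintype ι] [DecidableEq ι] [Fintype J]
    (n : ℕ) (x : ℕ → J → ι → ℝ) (w : ℕ → ι → ℝ) {R B : ℝ}
    (hx : ∀ t, ∑ j, ∑ s, |x t j s| ≤ 1) (hw : ∀ k < n, ∀ s, |w k s| ≤ R)
    (hB : ∀ k < n, ∑ t ∈ range k, (∑ j, |w k ⬝ᵥ x t j|) ^ 2 ≤ B) :
    ∑ k ∈ range n, ∑ j, |w k ⬝ᵥ x k j| ≤
      Fintype.card ι * √(n * (2 * (Fintype.card ι * R ^ 2 + B + R ^ 2) *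
        ((Fintype.card ι : ℝ) ^ 2 + Fintype.card ι * Real.log (1 + n)))) := by
  classical
  rcases Nat.eq_zero_or_pos n with rfl | hn
  · simp
  have hn' : (1 : ℝ) ≤ n := by exact_mod_cast hn
  set d : ℝ := (Fintype.card ι : ℝ)
  -- The padding vectors contribute at most `n * η ^ 2 * R ^ 2 ≤ R ^ 2` to the past sums.
  set η : ℝ := 1 / n
  have hη : 0 < η := by positivity
  have hη1 : η ≤ 1 := by rw [div_le_one (by positivity)]; exact hn'
  let sg : Bool → ℝ := fun b => if b then 1 else -1
  have hsg : ∀ b, |sg b| = 1 := by intro b; cases b <;> simp [sg]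
  let X : ℕ → Finset (ι → ℝ) := fun t =>
    (univ.image fun ε : J → Bool => ∑ j, sg (ε j) • x t j) ∪ univ.image fun s => Pi.single s η
  have hsp : ∀ t, ∃ v : ι → ι → ℝ, (∀ j, v j ∈ X t) ∧
      ∀ y ∈ X t, ∃ c : ι → ℝ, (∀ j, |c j| ≤ 1) ∧ y = ∑ j, c j • v j := fun t =>
    exists_spanner (X t) hη.ne' fun s => by simp [X]
  choose v hv hspan using hsp
  have hl1 : ∀ t j, ∑ s, |v t j s| ≤ 1 := by
    intro t j
    have h := hv t j
    simp only [X, mem_union, mem_image, mem_univ, true_and] at h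
    rcases h with ⟨ε, h⟩ | ⟨s, h⟩
    · rw [← h]
      refine le_trans ?_ (hx t)
      rw [Finset.sum_comm]
      refine Finset.sum_le_sum fun s _ => ?_
      rw [Finset.sum_apply]
      refine (Finset.abs_sum_le_sum_abs _ _).trans (Finset.sum_le_sum fun i _ => ?_)
      simp [abs_mul, hsg]
    · rw [← h]
      have : ∀ i, |(Pi.single s η : ι → ℝ) i| = if i = s then η else 0 := by
        intro i
        rw [Pi.single_apply]
        split_ifs <;> simp [hη.le]
      simp [this, hη1]
  have hle1 : ∀ t j s, |v t j s| ≤ 1 := fun t j s =>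
    (Finset.single_le_sum (f := fun s => |v t j s|) (fun _ _ => abs_nonneg _) (mem_univ s)).trans
      (hl1 t j)
  have hsq : ∀ t j, v t j ⬝ᵥ v t j ≤ 1 := by
    intro t j
    refine le_trans (Finset.sum_le_sum fun s _ => ?_) (hl1 t j)
    rw [← abs_mul_abs_self]
    exact mul_le_of_le_one_left (abs_nonneg _) (hle1 t j s)
  have hpast : ∀ k < n, ∀ t j, (w k ⬝ᵥ v t j) ^ 2 ≤ (∑ i, |w k ⬝ᵥ x t i|) ^ 2 + η ^ 2 * R ^ 2 := by
    intro k hk t j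
    have h := hv t j
    simp only [X, mem_union, mem_image, mem_univ, true_and] at h
    rcases h with ⟨ε, h⟩ | ⟨s, h⟩
    · refine le_add_of_le_of_nonneg ?_ (by positivity)
      rw [← h, ← sq_abs (w k ⬝ᵥ _), dotProduct_sum]
      refine pow_le_pow_left₀ (abs_nonneg _) ?_ 2
      refine (Finset.abs_sum_le_sum_abs _ _).trans (Finset.sum_le_sum fun i _ => ?_)
      rw [dotProduct_smul, smul_eq_mul, abs_mul, hsg, one_mul]
    · refine le_add_of_nonneg_of_le (by positivity) ?_
      rw [← h, dotProduct_single, mul_pow, mul_comm, ← sq_abs (w k s)]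
      gcongr
      exact hw k hk s
  have hcur : ∀ k, ∑ j, |w k ⬝ᵥ x k j| ≤ ∑ i, |w k ⬝ᵥ v k i| := by
    intro k
    let ε : J → Bool := fun j => decide (0 ≤ w k ⬝ᵥ x k j)
    have h1 : ∑ j, |w k ⬝ᵥ x k j| = w k ⬝ᵥ ∑ j, sg (ε j) • x k j := by
      rw [dotProduct_sum]
      refine Finset.sum_congr rfl fun j _ => ?_
      rw [dotProduct_smul, smul_eq_mul]
      by_cases h : 0 ≤ w k ⬝ᵥ x k j
      · simp [ε, sg, h]
      · simp [ε, sg, h, abs_of_neg (not_le.1 h)]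
    obtain ⟨c, hc, h2⟩ := hspan k (∑ j, sg (ε j) • x k j) (by simp [X])
    rw [h1, h2, dotProduct_sum]
    refine Finset.sum_le_sum fun i _ => ?_
    rw [dotProduct_smul, smul_eq_mul]
    refine (le_abs_self _).trans ?_
    rw [abs_mul]
    exact mul_le_of_le_one_left (abs_nonneg _) (hc i)
  have hpot : ∀ i, ∑ k ∈ range n, (w k ⬝ᵥ v k i) ^ 2 ≤
      2 * (d * R ^ 2 + B + R ^ 2) * (d ^ 2 + d * Real.log (1 + n)) := by
    intro i
    refine sum_sq_dotProduct_le (fun t => v t i) w hn (fun t => hle1 t i) (fun t => hsq t i) ?_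
    intro k hk
    have h1 : w k ⬝ᵥ w k ≤ d * R ^ 2 := by
      calc w k ⬝ᵥ w k ≤ ∑ _s : ι, R ^ 2 := by
            refine Finset.sum_le_sum fun s _ => ?_
            rw [← pow_two, ← sq_abs]
            gcongr
            exact hw k hk s
        _ = d * R ^ 2 := by simp [d]
    have h2 : ∑ t ∈ range k, (w k ⬝ᵥ v t i) ^ 2 ≤ B + R ^ 2 := by
      refine (Finset.sum_le_sum fun t _ => hpast k hk t i).trans ?_
      rw [Finset.sum_add_distrib]
      refine add_le_add (hB k hk) ?_
      rw [Finset.sum_const, card_range, nsmul_eq_mul, ← mul_assoc]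
      refine mul_le_of_le_one_left (sq_nonneg _) ?_
      have : (k : ℝ) ≤ n := by exact_mod_cast hk.le
      calc (k : ℝ) * η ^ 2 ≤ n * η ^ 2 := by gcongr
        _ = η := by simp only [η]; field_simp
        _ ≤ 1 := hη1
    linarith
  calc ∑ k ∈ range n, ∑ j, |w k ⬝ᵥ x k j| ≤ ∑ k ∈ range n, ∑ i, |w k ⬝ᵥ v k i| :=
        Finset.sum_le_sum fun k _ => hcur k
    _ = ∑ i, ∑ k ∈ range n, |w k ⬝ᵥ v k i| := Finset.sum_comm
    _ ≤ ∑ _i : ι, √(n * (2 * (d * R ^ 2 + B + R ^ 2) * (d ^ 2 + d * Real.log (1 + n)))) := by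
        refine Finset.sum_le_sum fun i _ => Real.le_sqrt_of_sq_le ?_
        refine (sq_sum_le_card_mul_sum_sq).trans ?_
        rw [card_range]
        simp only [sq_abs]
        gcongr
        exact hpot i
    _ = _ := by simp [d]

/-- A matrix whose least singular value is at least `α > 0` has a left inverse of operator norm at
most `√S / α` for the `ℓ¹` norms. -/
theorem exists_leftInverse_of_singularValues {𝒮 𝒪 : Type*} [Fintype 𝒮] [DecidableEq 𝒮] [Fintype 𝒪]
    (M : Matrix 𝒪 𝒮 ℝ) {α : ℝ} (hα : 0 < α)
    (hM : α ≤ (Matrix.toEuclideanLin M).singularValues (Fintype.card 𝒮 - 1)) :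
    ∃ P : Matrix 𝒮 𝒪 ℝ, P * M = 1 ∧
      ∀ v : 𝒪 → ℝ, ∑ s, |(P *ᵥ v) s| ≤ √(Fintype.card 𝒮) / α * ∑ o, |v o| := by
  classical
  set T := Matrix.toEuclideanLin M with hT
  have hfin : Module.finrank ℝ (EuclideanSpace ℝ 𝒮) = Fintype.card 𝒮 := by simp
  -- `‖T v‖²` is a combination of the eigenvalues of `T* T`, all of which are at least `α²`.
  have hlow : ∀ v, α * ‖v‖ ≤ ‖T v‖ := by
    intro v
    have hsymm := T.isSymmetric_adjoint_comp_self
    set b := hsymm.eigenvectorBasis hfin with hb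
    have hsum : ‖T v‖ ^ 2 = ∑ i, hsymm.eigenvalues hfin i * ‖inner ℝ (b i) v‖ ^ 2 := by
      have h1 : ‖T v‖ ^ 2 = inner ℝ ((LinearMap.adjoint T ∘ₗ T) v) v := by
        rw [LinearMap.comp_apply, LinearMap.adjoint_inner_left, real_inner_self_eq_norm_sq]
      rw [h1, ← b.sum_inner_mul_inner]
      refine Finset.sum_congr rfl fun i _ => ?_
      rw [hsymm, hb, hsymm.apply_eigenvectorBasis, inner_smul_right, ← hb, Real.norm_eq_abs, sq_abs,
        real_inner_comm (b i) v]
      simp only [RCLike.ofReal_real_eq_id, id_eq]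
      ring
    have hev : ∀ i, α ^ 2 ≤ hsymm.eigenvalues hfin i := by
      intro i
      rw [← T.sq_singularValues_fin hfin i]
      refine pow_le_pow_left₀ hα.le (hM.trans (T.singularValues_antitone ?_)) 2
      have := i.isLt
      omega
    refine le_of_sq_le_sq ?_ (norm_nonneg _)
    rw [hsum, mul_pow, ← b.sum_sq_norm_inner_right v, Finset.mul_sum]
    exact Finset.sum_le_sum fun i _ => mul_le_mul_of_nonneg_right (hev i) (sq_nonneg _)
  have hker : T.ker = ⊥ := by
    rw [LinearMap.ker_eq_bot']
    intro v hv
    have := hlow v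
    rw [hv, norm_zero] at this
    exact norm_le_zero_iff.1 (nonpos_of_mul_nonpos_right this hα)
  obtain ⟨g, hg⟩ := T.exists_leftInverse_of_injective hker
  -- Composing with the orthogonal projection onto the range keeps the norm at most `1 / α`.
  let Q : EuclideanSpace ℝ 𝒪 →ₗ[ℝ] EuclideanSpace ℝ 𝒮 :=
    g ∘ₗ (T.range.starProjection : EuclideanSpace ℝ 𝒪 →L[ℝ] EuclideanSpace ℝ 𝒪).toLinearMap
  have hQT : ∀ v, Q (T v) = v := by
    intro v
    have h1 : T.range.starProjection (T v) = T v :=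
      Submodule.starProjection_eq_self_iff.2 ⟨v, rfl⟩
    change g (T.range.starProjection (T v)) = v
    rw [h1]
    exact LinearMap.congr_fun hg v
  have hQ : ∀ u, ‖Q u‖ ≤ ‖u‖ / α := by
    intro u
    obtain ⟨v, hv⟩ : T.range.starProjection u ∈ T.range := Submodule.starProjection_apply_mem _ _
    have h1 : Q u = v := by
      change g (T.range.starProjection u) = v
      rw [← hv]
      exact LinearMap.congr_fun hg v
    rw [h1, le_div_iff₀ hα, mul_comm]
    refine (hlow v).trans ?_
    rw [hv]
    exact Submodule.norm_starProjection_apply_le _ u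
  refine ⟨Matrix.toEuclideanLin.symm Q, ?_, fun v => ?_⟩
  · apply Matrix.toEuclideanLin.injective
    apply LinearMap.ext
    intro v
    have h2 : Matrix.toEuclideanLin (Matrix.toEuclideanLin.symm Q * M) v = Q (T v) := by
      conv_rhs => rw [← Matrix.toEuclideanLin.apply_symm_apply Q]
      simp [T]
    rw [h2, hQT]
    simp
  · have h3 : (Matrix.toEuclideanLin.symm Q) *ᵥ v = (Q (WithLp.toLp 2 v)).ofLp := by
      conv_rhs => rw [← Matrix.toEuclideanLin.apply_symm_apply Q]
      rfl
    rw [h3]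
    set y := Q (WithLp.toLp 2 v)
    have h4 : ∑ s, |y s| ≤ √(Fintype.card 𝒮) * ‖y‖ := by
      rw [EuclideanSpace.norm_eq, ← Real.sqrt_mul (Nat.cast_nonneg _)]
      refine Real.le_sqrt_of_sq_le ?_
      simpa using sq_sum_le_card_mul_sum_sq (s := univ) (f := fun s => |y s|)
    have h5 : ‖WithLp.toLp 2 v‖ ≤ ∑ o, |v o| := by
      rw [EuclideanSpace.norm_eq]
      refine Real.sqrt_le_iff.2 ⟨Finset.sum_nonneg fun _ _ => abs_nonneg _, ?_⟩
      simpa using Finset.sum_sq_le_sq_sum_of_nonneg (s := univ) (f := fun o => |v o|)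
        fun _ _ => abs_nonneg _
    calc ∑ s, |y s| ≤ √(Fintype.card 𝒮) * ‖y‖ := h4
      _ ≤ √(Fintype.card 𝒮) * ((∑ o, |v o|) / α) := by
          gcongr
          exact (hQ _).trans (by gcongr)
      _ = _ := by ring

/-! ### Beliefs and the forward recursion -/

section Belief

variable {H : ℕ} {𝒮 𝒜 𝒪 : Type*} [Fintype 𝒮] [Fintype 𝒜] [Fintype 𝒪]

/-- A trajectory extended by one step. -/
def Traj.snoc {𝒪 𝒜 : Type*} {n : ℕ} (τ : Traj n 𝒪 𝒜) (x : 𝒪 × 𝒜) : Traj (n + 1) 𝒪 𝒜 :=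
  Fin.snoc (α := fun _ => 𝒪 × 𝒜) τ x

@[simp] theorem Traj.snoc_last {𝒪 𝒜 : Type*} {n : ℕ} (τ : Traj n 𝒪 𝒜) (x : 𝒪 × 𝒜) :
    τ.snoc x (Fin.last n) = x :=
  Fin.snoc_last (α := fun _ => 𝒪 × 𝒜) x τ

@[simp] theorem Traj.snoc_castSucc {𝒪 𝒜 : Type*} {n : ℕ} (τ : Traj n 𝒪 𝒜) (x : 𝒪 × 𝒜)
    (i : Fin n) : τ.snoc x i.castSucc = τ i :=
  Fin.snoc_castSucc (α := fun _ => 𝒪 × 𝒜) x τ i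

theorem sum_traj_succ {𝒪 𝒜 : Type*} [Fintype 𝒪] [Fintype 𝒜] {n : ℕ}
    (F : Traj (n + 1) 𝒪 𝒜 → ℝ) : ∑ τ, F τ = ∑ τ : Traj n 𝒪 𝒜, ∑ x, F (τ.snoc x) := by
  rw [← (Fin.snocEquiv fun _ : Fin (n + 1) => 𝒪 × 𝒜).sum_comp, Fintype.sum_prod_type_right]
  rfl

theorem Policy.weight_snoc {H : ℕ} {𝒜 𝒪 : Type*} [Fintype 𝒜] (π : Policy H 𝒜 𝒪) {n : ℕ}
    (hn : n + 1 ≤ H) (τ : Traj n 𝒪 𝒜) (x : 𝒪 × 𝒜) :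
    π.weight hn (τ.snoc x) =
      π.weight ((Nat.le_succ n).trans hn) τ * π.act ⟨n, hn⟩ τ x.1 x.2 := by
  rw [Policy.weight, Fin.prod_univ_castSucc, Policy.weight, Traj.snoc_last]
  congr 1
  · refine Finset.prod_congr rfl fun h _ => ?_
    have h1 : Traj.pre (τ.snoc x) (h.castSucc : Fin (n + 1)) h.castSucc.isLt.le =
        τ.pre h h.isLt.le := by
      funext i
      exact Traj.snoc_castSucc τ x (Fin.castLE h.isLt.le i)
    rw [Traj.snoc_castSucc]
    exact congrArg (fun g => π.act (Fin.castLE hn h.castSucc) g (τ h).1 (τ h).2) h1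
  · have h1 : Traj.pre (τ.snoc x) (Fin.last n : Fin (n + 1)) (Fin.last n).isLt.le = τ := by
      funext i
      exact Traj.snoc_castSucc τ x i
    exact congrArg (fun g => π.act ⟨n, hn⟩ g x.1 x.2) h1

/-- Averaging a function of the observation over the next step of the policy. -/
theorem Policy.sum_weight_snoc (π : Policy H 𝒜 𝒪) {n : ℕ} (hn : n + 1 ≤ H) (τ : Traj n 𝒪 𝒜)
    (F : 𝒪 → ℝ) :
    ∑ x, π.weight hn (τ.snoc x) * F x.1 = π.weight ((Nat.le_succ n).trans hn) τ * ∑ o, F o := by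
  rw [Fintype.sum_prod_type, Finset.mul_sum]
  refine Finset.sum_congr rfl fun o _ => ?_
  simp only [π.weight_snoc]
  rw [← Finset.sum_mul, ← Finset.mul_sum, (π.act_mem _ _ _).2, mul_one]

variable [DecidableEq 𝒮]

/-- The emission matrix at step `n`, indexed by a natural number; indices from `H` on wrap around,
so that the matrix is always stochastic. -/
def Params.em [NeZero H] (θ : Params H 𝒮 𝒜 𝒪) (n : ℕ) : Matrix 𝒪 𝒮 ℝ := θ.emis (Fin.ofNat H n)

/-- The transition matrix at step `n`, indexed by a natural number; the state does not move from
step `H - 1` on. -/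
def Params.tr (θ : Params H 𝒮 𝒜 𝒪) (n : ℕ) (a : 𝒜) : Matrix 𝒮 𝒮 ℝ :=
  if h : n < H - 1 then θ.trans ⟨n, h⟩ a else 1

/-- `step n (o, a)` propagates unnormalized beliefs: it observes `o` and then moves under `a`. -/
def Params.step [NeZero H] (θ : Params H 𝒮 𝒜 𝒪) (n : ℕ) (x : 𝒪 × 𝒜) : Matrix 𝒮 𝒮 ℝ :=
  Matrix.of fun s' s => θ.tr n x.2 s' s * θ.em n x.1 s

/-- The unnormalized belief after the trajectory `τ`: the probability of the latent state together
with the observations of `τ`, given its actions. -/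
def Params.belief [NeZero H] (θ : Params H 𝒮 𝒜 𝒪) : (n : ℕ) → Traj n 𝒪 𝒜 → 𝒮 → ℝ
  | 0, _ => θ.init
  | n + 1, τ => θ.step n (τ (Fin.last n)) *ᵥ θ.belief n fun i => τ i.castSucc

variable [NeZero H] (θ : Params H 𝒮 𝒜 𝒪)

theorem Params.em_nonneg (n : ℕ) (o : 𝒪) (s : 𝒮) : 0 ≤ θ.em n o s := (θ.emis_mem _ s).1 o

theorem Params.sum_em (n : ℕ) (s : 𝒮) : ∑ o, θ.em n o s = 1 := (θ.emis_mem _ s).2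

theorem Params.tr_nonneg (n : ℕ) (a : 𝒜) (s' s : 𝒮) : 0 ≤ θ.tr n a s' s := by
  rw [Params.tr]
  split_ifs with h
  · exact (θ.trans_mem _ _ s).1 s'
  · rw [Matrix.one_apply]; split_ifs <;> simp

theorem Params.sum_tr (n : ℕ) (a : 𝒜) (s : 𝒮) : ∑ s', θ.tr n a s' s = 1 := by
  rw [Params.tr]
  split_ifs with h
  · exact (θ.trans_mem _ _ s).2
  · simp [Matrix.one_apply]

@[simp] theorem Params.belief_snoc {n : ℕ} (τ : Traj n 𝒪 𝒜) (x : 𝒪 × 𝒜) :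
    θ.belief (n + 1) (τ.snoc x) = θ.step n x *ᵥ θ.belief n τ := by
  rw [Params.belief, Traj.snoc_last]
  congr 2
  funext i
  exact Traj.snoc_castSucc τ x i

theorem Params.belief_nonneg {n : ℕ} (τ : Traj n 𝒪 𝒜) (s : 𝒮) : 0 ≤ θ.belief n τ s := by
  induction n generalizing s with
  | zero => exact θ.init_mem.1 s
  | succ n ih =>
    exact Finset.sum_nonneg fun i _ =>
      mul_nonneg (mul_nonneg (θ.tr_nonneg _ _ _ _) (θ.em_nonneg _ _ _)) (ih _ _)

theorem Params.sum_step_mulVec (n : ℕ) (x : 𝒪 × 𝒜) (v : 𝒮 → ℝ) :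
    ∑ s', (θ.step n x *ᵥ v) s' = (θ.em n *ᵥ v) x.1 := by
  simp only [Matrix.mulVec, dotProduct, Params.step, Matrix.of_apply]
  rw [Finset.sum_comm]
  refine Finset.sum_congr rfl fun s _ => ?_
  rw [← Finset.sum_mul, ← Finset.sum_mul, θ.sum_tr, one_mul]

theorem Params.sum_em_mulVec (n : ℕ) (v : 𝒮 → ℝ) : ∑ o, (θ.em n *ᵥ v) o = ∑ s, v s := by
  simp only [Matrix.mulVec, dotProduct]
  rw [Finset.sum_comm]
  refine Finset.sum_congr rfl fun s _ => ?_
  rw [← Finset.sum_mul, θ.sum_em, one_mul]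

/-- Propagating a signed vector through one step has `ℓ¹` norm at most the mass that its absolute
value gives to the observation, because transition matrices are stochastic. -/
theorem sum_abs_step_mulVec_le (n : ℕ) (x : 𝒪 × 𝒜) (v : 𝒮 → ℝ) :
    ∑ s', |(θ.step n x *ᵥ v) s'| ≤ (θ.em n *ᵥ fun s => |v s|) x.1 := by
  rw [← θ.sum_step_mulVec]
  refine Finset.sum_le_sum fun s' _ => (Finset.abs_sum_le_sum_abs _ _).trans_eq ?_
  refine Finset.sum_congr rfl fun s _ => ?_
  rw [abs_mul, abs_of_nonneg]
  exact mul_nonneg (θ.tr_nonneg _ _ _ _) (θ.em_nonneg _ _ _)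

theorem sum_abs_em_mulVec_le (n : ℕ) (v : 𝒮 → ℝ) : ∑ o, |(θ.em n *ᵥ v) o| ≤ ∑ s, |v s| := by
  rw [← θ.sum_em_mulVec n fun s => |v s|]
  refine Finset.sum_le_sum fun o _ => (Finset.abs_sum_le_sum_abs _ _).trans_eq ?_
  refine Finset.sum_congr rfl fun s _ => ?_
  rw [abs_mul, abs_of_nonneg (θ.em_nonneg _ _ _)]

/-- On average over the next step of the policy, propagation does not increase the `ℓ¹` norm. -/
theorem sum_weight_mul_abs_step_le (π : Policy H 𝒜 𝒪) {n : ℕ} (hn : n + 1 ≤ H)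
    (τ : Traj n 𝒪 𝒜) (v : 𝒮 → ℝ) :
    ∑ x, π.weight hn (τ.snoc x) * ∑ s', |(θ.step n x *ᵥ v) s'| ≤
      π.weight ((Nat.le_succ n).trans hn) τ * ∑ s, |v s| := by
  refine (Finset.sum_le_sum fun x _ => mul_le_mul_of_nonneg_left (sum_abs_step_mulVec_le θ n x v)
    (π.weight_nonneg _ _)).trans_eq ?_
  rw [π.sum_weight_snoc hn τ fun o => (θ.em n *ᵥ fun s => |v s|) o, θ.sum_em_mulVec]

/-- The total probability of all trajectories of a given length is one. -/
theorem sum_weight_mul_sum_belief (π : Policy H 𝒜 𝒪) {n : ℕ} (hn : n ≤ H) :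
    ∑ τ : Traj n 𝒪 𝒜, π.weight hn τ * ∑ s, θ.belief n τ s = 1 := by
  induction n with
  | zero =>
    rw [Fintype.sum_unique]
    simpa [Policy.weight, Params.belief] using θ.init_mem.2
  | succ n ih =>
    rw [sum_traj_succ]
    simp only [θ.belief_snoc, θ.sum_step_mulVec]
    rw [← ih ((Nat.le_succ n).trans hn)]
    refine Finset.sum_congr rfl fun τ _ => ?_
    rw [π.sum_weight_snoc hn τ fun o => (θ.em n *ᵥ θ.belief n τ) o, θ.sum_em_mulVec]

/-- Summation over latent paths is the forward recursion. -/
theorem Params.sum_paths (n : ℕ) (τ : Traj n 𝒪 𝒜) (g : 𝒮 → ℝ) :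
    ∑ s : Fin (n + 1) → 𝒮, θ.init (s 0) * (∏ h : Fin n, θ.em h (τ h).1 (s h.castSucc)) *
      (∏ h : Fin n, θ.tr h (τ h).2 (s h.succ) (s h.castSucc)) * g (s (Fin.last n)) =
    ∑ s, θ.belief n τ s * g s := by
  induction n generalizing g with
  | zero =>
    rw [← (Equiv.funUnique (Fin 1) 𝒮).symm.sum_comp]
    simp [Params.belief]
  | succ n ih =>
    rw [← (Fin.snocEquiv fun _ : Fin (n + 1 + 1) => 𝒮).sum_comp, Fintype.sum_prod_type_right]
    have hl : ∀ (y : Fin (n + 1) → 𝒮) (a : 𝒮),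
        (Fin.snocEquiv fun _ : Fin (n + 1 + 1) => 𝒮) (a, y) (Fin.last (n + 1)) = a := fun y a =>
      Fin.snoc_last (α := fun _ : Fin (n + 1 + 1) => 𝒮) a y
    have hc : ∀ (y : Fin (n + 1) → 𝒮) (a : 𝒮) (i : Fin (n + 1)),
        (Fin.snocEquiv fun _ : Fin (n + 1 + 1) => 𝒮) (a, y) i.castSucc = y i := fun y a i =>
      Fin.snoc_castSucc (α := fun _ : Fin (n + 1 + 1) => 𝒮) a y i
    have h0 : ∀ (y : Fin (n + 1) → 𝒮) (a : 𝒮),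
        (Fin.snocEquiv fun _ : Fin (n + 1 + 1) => 𝒮) (a, y) 0 = y 0 := fun y a => hc y a 0
    have hs : ∀ (y : Fin (n + 1) → 𝒮) (a : 𝒮) (i : Fin n),
        (Fin.snocEquiv fun _ : Fin (n + 1 + 1) => 𝒮) (a, y) i.castSucc.succ = y i.succ :=
      fun y a i => hc y a i.succ
    simp only [Fin.prod_univ_castSucc, Fin.succ_last, hl, hc, h0, hs]
    have := ih (fun i => τ i.castSucc) fun s => ∑ s', θ.step n (τ (Fin.last n)) s' s * g s'
    simp only [Params.belief, Matrix.mulVec, dotProduct, Finset.sum_mul]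
    conv_rhs => rw [Finset.sum_comm]
    refine Eq.trans ?_ (this.trans ?_)
    · refine Finset.sum_congr rfl fun y _ => ?_
      rw [Finset.mul_sum]
      refine Finset.sum_congr rfl fun a _ => ?_
      simp only [Params.step, Matrix.of_apply, Fin.val_castSucc, Fin.val_last]
      ring
    · refine Finset.sum_congr rfl fun y _ => ?_
      rw [Finset.mul_sum]
      exact Finset.sum_congr rfl fun a _ => by ring

theorem trajProb_eq_weight_mul_sum_belief (π : Policy H 𝒜 𝒪) (τ : Traj H 𝒪 𝒜) :
    trajProb θ π τ = π.weight le_rfl τ * ∑ s, θ.belief H τ s := by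
  obtain ⟨n, rfl⟩ : ∃ n, H = n + 1 := Nat.exists_eq_succ_of_ne_zero (NeZero.ne H)
  rw [trajProb]
  congr 1
  rw [Params.belief, θ.sum_step_mulVec, Matrix.mulVec, dotProduct]
  have h := θ.sum_paths n (fun i => τ i.castSucc) fun s => θ.em n (τ (Fin.last n)).1 s
  simp only [mul_comm (θ.em n _ _)]
  rw [← h]
  refine Finset.sum_congr rfl fun s _ => ?_
  rw [Fin.prod_univ_castSucc]
  have h1 : ∀ m : ℕ, ∀ hm : m < n + 1, Fin.ofNat (n + 1) m = ⟨m, hm⟩ := fun m hm =>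
    Fin.ext (Nat.mod_eq_of_lt hm)
  have h2 : ∀ m : Fin n, θ.tr m = θ.trans m := by
    intro m
    funext a
    exact dif_pos m.isLt
  have h3 : ∀ m : Fin n, θ.em m = θ.emis m.castSucc := fun m => by
    rw [Params.em, h1 m (m.isLt.trans (Nat.lt_succ_self n))]; rfl
  have h4 : θ.em n = θ.emis (Fin.last n) := by
    rw [Params.em, h1 n (Nat.lt_succ_self n)]; rfl
  simp only [h2, h3, h4]
  have h5 : (∏ h : Fin (n + 1 - 1), θ.trans h (τ ⟨h, by omega⟩).2 (s ⟨h + 1, by omega⟩)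
      (s ⟨h, by omega⟩)) =
      ∏ h : Fin n, θ.trans h (τ h.castSucc).2 (s h.succ) (s h.castSucc) := rfl
  rw [h5]
  ring

end Belief

/-! ### Comparing two models along one policy -/

section Compare

variable {H : ℕ} {𝒮 𝒜 𝒪 : Type*} [Fintype 𝒮] [Fintype 𝒜] [Fintype 𝒪] [NeZero H]

/-- The `ℓ¹` distance of the trajectory laws of two models under the policy `π`. -/
def trajDist (θ θ' : Params H 𝒮 𝒜 𝒪) (π : Policy H 𝒜 𝒪) : ℝ :=
  ∑ τ : Traj H 𝒪 𝒜, |trajProb θ π τ - trajProb θ' π τ|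

theorem trajDist_nonneg (θ θ' : Params H 𝒮 𝒜 𝒪) (π : Policy H 𝒜 𝒪) : 0 ≤ trajDist θ θ' π :=
  Finset.sum_nonneg fun _ _ => abs_nonneg _

variable [DecidableEq 𝒮]

/-- The `ℓ¹` distance of the laws of `(o₁, a₁, …, oₙ, aₙ)`. -/
def preDist (θ θ' : Params H 𝒮 𝒜 𝒪) (π : Policy H 𝒜 𝒪) {n : ℕ} (hn : n ≤ H) : ℝ :=
  ∑ τ : Traj n 𝒪 𝒜, π.weight hn τ * |∑ s, θ.belief n τ s - ∑ s, θ'.belief n τ s|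

/-- The `ℓ¹` distance of the laws of `(o₁, a₁, …, oₙ, aₙ, oₙ₊₁)`. -/
def obsDist (θ θ' : Params H 𝒮 𝒜 𝒪) (π : Policy H 𝒜 𝒪) {n : ℕ} (hn : n ≤ H) : ℝ :=
  ∑ τ : Traj n 𝒪 𝒜, π.weight hn τ *
    ∑ o, |(θ.em n *ᵥ θ.belief n τ) o - (θ'.em n *ᵥ θ'.belief n τ) o|

variable (θ θ' : Params H 𝒮 𝒜 𝒪) (π : Policy H 𝒜 𝒪)

theorem preDist_eq_trajDist : preDist θ θ' π le_rfl = trajDist θ θ' π := by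
  refine Finset.sum_congr rfl fun τ _ => ?_
  rw [trajProb_eq_weight_mul_sum_belief, trajProb_eq_weight_mul_sum_belief, ← mul_sub, abs_mul,
    abs_of_nonneg (π.weight_nonneg _ _)]

/-- The action carries no information beyond the history and the observation, as both models use
the same policy. -/
theorem obsDist_eq_preDist_succ {n : ℕ} (hn : n + 1 ≤ H) :
    obsDist θ θ' π ((Nat.le_succ n).trans hn) = preDist θ θ' π hn := by
  rw [preDist, sum_traj_succ]
  refine Finset.sum_congr rfl fun τ _ => ?_
  simp only [Params.belief_snoc, Params.sum_step_mulVec]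
  rw [π.sum_weight_snoc hn τ fun o =>
    |(θ.em n *ᵥ θ.belief n τ) o - (θ'.em n *ᵥ θ'.belief n τ) o|]

theorem preDist_le_obsDist {n : ℕ} (hn : n ≤ H) : preDist θ θ' π hn ≤ obsDist θ θ' π hn := by
  refine Finset.sum_le_sum fun τ _ => mul_le_mul_of_nonneg_left ?_ (π.weight_nonneg _ _)
  rw [← θ.sum_em_mulVec n, ← θ'.sum_em_mulVec n, ← Finset.sum_sub_distrib]
  exact Finset.abs_sum_le_sum_abs _ _

theorem preDist_le_trajDist {n : ℕ} (hn : n ≤ H) : preDist θ θ' π hn ≤ trajDist θ θ' π := by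
  induction hn using Nat.decreasingInduction with
  | self => rw [preDist_eq_trajDist]
  | of_succ k hk ih =>
    refine (preDist_le_obsDist θ θ' π _).trans ?_
    rw [obsDist_eq_preDist_succ θ θ' π hk]
    exact ih

theorem obsDist_le_trajDist {n : ℕ} (hn : n + 1 ≤ H) :
    obsDist θ θ' π ((Nat.le_succ n).trans hn) ≤ trajDist θ θ' π := by
  rw [obsDist_eq_preDist_succ θ θ' π hn]
  exact preDist_le_trajDist θ θ' π hn

variable (P : ℕ → Matrix 𝒮 𝒪 ℝ)

/-- The mean `ℓ¹` distance between the belief of `θ` and the belief that the left inverses `P` of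
the emission matrices of `θ` reconstruct from the predicted observation of `θ'`. -/
def latentDist {n : ℕ} (hn : n ≤ H) : ℝ :=
  ∑ τ : Traj n 𝒪 𝒜, π.weight hn τ *
    ∑ s, |θ.belief n τ s - (P n *ᵥ θ'.em n *ᵥ θ'.belief n τ) s|

/-- The discrepancy of the one-step dynamics of `θ` and `θ'`, as a matrix acting on beliefs
of `θ'`. -/
def stepGap (n : ℕ) (x : 𝒪 × 𝒜) : Matrix 𝒮 𝒮 ℝ :=
  θ.step n x * (P n * θ'.em n) - P (n + 1) * θ'.em (n + 1) * θ'.step n x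

/-- The discrepancy of the predictions of the next observation, as a matrix acting on beliefs
of `θ'`. -/
def emGap (n : ℕ) : Matrix 𝒪 𝒮 ℝ := θ.em n * (P n * θ'.em n) - θ'.em n

/-- The mean `ℓ¹` norm of `stepGap` along the policy. -/
def stepErr {n : ℕ} (hn : n + 1 ≤ H) : ℝ :=
  ∑ τ : Traj n 𝒪 𝒜, ∑ x, π.weight hn (τ.snoc x) * ∑ s, |(stepGap θ θ' P n x *ᵥ θ'.belief n τ) s|

/-- The mean `ℓ¹` norm of `emGap` along the policy. -/
def emErr {n : ℕ} (hn : n ≤ H) : ℝ :=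
  ∑ τ : Traj n 𝒪 𝒜, π.weight hn τ * ∑ o, |(emGap θ θ' P n *ᵥ θ'.belief n τ) o|

variable {P} {L : ℝ}

theorem latentDist_le (hP : ∀ n, P n * θ.em n = 1)
    (hL : ∀ n (v : 𝒪 → ℝ), ∑ s, |(P n *ᵥ v) s| ≤ L * ∑ o, |v o|) {n : ℕ} (hn : n + 1 ≤ H) :
    latentDist θ θ' π P ((Nat.le_succ n).trans hn) ≤
      L * obsDist θ θ' π ((Nat.le_succ n).trans hn) := by
  rw [latentDist, obsDist, Finset.mul_sum]
  refine Finset.sum_le_sum fun τ _ => ?_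
  rw [mul_left_comm]
  refine mul_le_mul_of_nonneg_left ?_ (π.weight_nonneg _ _)
  refine le_trans (le_of_eq ?_) (hL n _)
  refine Finset.sum_congr rfl fun s _ => ?_
  congr 1
  have h : θ.belief n τ = P n *ᵥ θ.em n *ᵥ θ.belief n τ := by
    rw [Matrix.mulVec_mulVec, hP, Matrix.one_mulVec]
  conv_lhs => rw [h]
  rw [← Pi.sub_apply, ← Matrix.mulVec_sub]
  rfl

/-- The pointwise identity behind the telescoping argument: the latent error after a step is the
propagated latent error plus the discrepancy of the step. -/
theorem belief_snoc_sub {n : ℕ} (τ : Traj n 𝒪 𝒜) (x : 𝒪 × 𝒜) :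
    (fun s => θ.belief (n + 1) (τ.snoc x) s -
      (P (n + 1) *ᵥ θ'.em (n + 1) *ᵥ θ'.belief (n + 1) (τ.snoc x)) s) =
    θ.step n x *ᵥ (fun s => θ.belief n τ s - (P n *ᵥ θ'.em n *ᵥ θ'.belief n τ) s) +
      stepGap θ θ' P n x *ᵥ θ'.belief n τ := by
  have h : (fun s => θ.belief n τ s - (P n *ᵥ θ'.em n *ᵥ θ'.belief n τ) s) =
    θ.belief n τ - P n *ᵥ θ'.em n *ᵥ θ'.belief n τ := rfl
  rw [h, Matrix.mulVec_sub, stepGap, Matrix.sub_mulVec]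
  simp only [Params.belief_snoc, Matrix.mulVec_mulVec, Matrix.mul_assoc]
  funext s
  simp

theorem latentDist_succ_le {n : ℕ} (hn : n + 1 ≤ H) :
    latentDist θ θ' π P hn ≤
      latentDist θ θ' π P ((Nat.le_succ n).trans hn) + stepErr θ θ' π P hn := by
  rw [latentDist, latentDist, stepErr, sum_traj_succ, ← Finset.sum_add_distrib]
  refine Finset.sum_le_sum fun τ _ => ?_
  refine le_trans ?_ (add_le_add_left (sum_weight_mul_abs_step_le θ π hn τ _) _)
  rw [← Finset.sum_add_distrib]
  refine Finset.sum_le_sum fun x _ => ?_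
  rw [← mul_add, ← Finset.sum_add_distrib]
  refine mul_le_mul_of_nonneg_left (Finset.sum_le_sum fun s _ => ?_) (π.weight_nonneg _ _)
  have h := congrFun (belief_snoc_sub θ θ' (P := P) τ x) s
  simp only [Pi.add_apply] at h
  rw [h]
  exact abs_add_le _ _

theorem stepErr_le_add {n : ℕ} (hn : n + 1 ≤ H) :
    stepErr θ θ' π P hn ≤
      latentDist θ θ' π P ((Nat.le_succ n).trans hn) + latentDist θ θ' π P hn := by
  rw [latentDist, latentDist, stepErr, sum_traj_succ, ← Finset.sum_add_distrib]
  refine Finset.sum_le_sum fun τ _ => ?_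
  refine le_trans ?_ (add_le_add_left (sum_weight_mul_abs_step_le θ π hn τ _) _)
  rw [← Finset.sum_add_distrib]
  refine Finset.sum_le_sum fun x _ => ?_
  rw [← mul_add, ← Finset.sum_add_distrib]
  refine mul_le_mul_of_nonneg_left (Finset.sum_le_sum fun s _ => ?_) (π.weight_nonneg _ _)
  have h := congrFun (belief_snoc_sub θ θ' (P := P) τ x) s
  simp only [Pi.add_apply] at h
  rw [h, add_comm]
  set a := (stepGap θ θ' P n x *ᵥ θ'.belief n τ) s
  set b := (θ.step n x *ᵥ (fun s => θ.belief n τ s - (P n *ᵥ θ'.em n *ᵥ θ'.belief n τ) s)) s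
  calc |a| = |(b + a) - b| := by rw [add_sub_cancel_left]
    _ ≤ |b + a| + |b| := abs_sub _ _

theorem em_mulVec_sub {n : ℕ} (τ : Traj n 𝒪 𝒜) (o : 𝒪) :
    (θ.em n *ᵥ θ.belief n τ) o - (θ'.em n *ᵥ θ'.belief n τ) o =
    (θ.em n *ᵥ (fun s => θ.belief n τ s - (P n *ᵥ θ'.em n *ᵥ θ'.belief n τ) s)) o +
      (emGap θ θ' P n *ᵥ θ'.belief n τ) o := by
  have h : (fun s => θ.belief n τ s - (P n *ᵥ θ'.em n *ᵥ θ'.belief n τ) s) =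
    θ.belief n τ - P n *ᵥ θ'.em n *ᵥ θ'.belief n τ := rfl
  rw [h, Matrix.mulVec_sub, emGap, Matrix.sub_mulVec]
  simp [Matrix.mulVec_mulVec]

theorem obsDist_le_add {n : ℕ} (hn : n ≤ H) :
    obsDist θ θ' π hn ≤ latentDist θ θ' π P hn + emErr θ θ' π P hn := by
  rw [latentDist, emErr, obsDist, ← Finset.sum_add_distrib]
  refine Finset.sum_le_sum fun τ _ => ?_
  rw [← mul_add]
  refine mul_le_mul_of_nonneg_left ?_ (π.weight_nonneg _ _)
  refine le_trans ?_ (add_le_add_left (sum_abs_em_mulVec_le θ n _) _)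
  rw [← Finset.sum_add_distrib]
  refine Finset.sum_le_sum fun o _ => ?_
  rw [em_mulVec_sub θ θ' (P := P)]
  exact abs_add_le _ _

theorem emErr_le_add {n : ℕ} (hn : n ≤ H) :
    emErr θ θ' π P hn ≤ latentDist θ θ' π P hn + obsDist θ θ' π hn := by
  rw [latentDist, emErr, obsDist, ← Finset.sum_add_distrib]
  refine Finset.sum_le_sum fun τ _ => ?_
  rw [← mul_add]
  refine mul_le_mul_of_nonneg_left ?_ (π.weight_nonneg _ _)
  refine le_trans ?_ (add_le_add_left (sum_abs_em_mulVec_le θ n _) _)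
  rw [← Finset.sum_add_distrib]
  refine Finset.sum_le_sum fun o _ => ?_
  rw [em_mulVec_sub θ θ' (P := P)]
  set a := (emGap θ θ' P n *ᵥ θ'.belief n τ) o
  set b := (θ.em n *ᵥ (fun s => θ.belief n τ s - (P n *ᵥ θ'.em n *ᵥ θ'.belief n τ) s)) o
  calc |a| = |(b + a) - b| := by rw [add_sub_cancel_left]
    _ ≤ |b + a| + |b| := abs_sub _ _
    _ = _ := add_comm _ _

theorem latentDist_le_sum_stepErr {n : ℕ} (hn : n ≤ H) :
    latentDist θ θ' π P hn ≤ latentDist θ θ' π P (Nat.zero_le H) +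
      ∑ m : Fin n, stepErr θ θ' π P (Nat.succ_le_of_lt (m.isLt.trans_le hn)) := by
  induction n with
  | zero => simp
  | succ n ih =>
    rw [Fin.sum_univ_castSucc, ← add_assoc]
    exact (latentDist_succ_le θ θ' π hn).trans
      (add_le_add_left (ih ((Nat.le_succ n).trans hn)) _)

/-- The distance of the laws is at most the sum of the one-step discrepancies, measured on the
beliefs of `θ'`. -/
theorem trajDist_le_sum {n : ℕ} (hn : n + 1 = H) :
    trajDist θ θ' π ≤ latentDist θ θ' π P (Nat.zero_le H) +
      ∑ m : Fin n, stepErr θ θ' π P (n := m) (by omega) +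
      emErr θ θ' π P (n := n) (by omega) := by
  rw [← preDist_eq_trajDist]
  have h1 : preDist θ θ' π (le_refl H) = preDist θ θ' π hn.le := by subst hn; rfl
  rw [h1, ← obsDist_eq_preDist_succ]
  exact (obsDist_le_add θ θ' π (P := P) _).trans
    (add_le_add_left (latentDist_le_sum_stepErr θ θ' π (n := n) (by omega)) _)

section Past

variable (hP : ∀ n, P n * θ.em n = 1)
  (hL : ∀ n (v : 𝒪 → ℝ), ∑ s, |(P n *ᵥ v) s| ≤ L * ∑ o, |v o|) (hL0 : 0 ≤ L)

include hP hL hL0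

theorem latentDist_le_trajDist {n : ℕ} (hn : n + 1 ≤ H) :
    latentDist θ θ' π P ((Nat.le_succ n).trans hn) ≤ L * trajDist θ θ' π :=
  (latentDist_le θ θ' π hP hL hn).trans
    (mul_le_mul_of_nonneg_left (obsDist_le_trajDist θ θ' π hn) hL0)

/-- Each one-step discrepancy is controlled by the observable distance of the laws. -/
theorem stepErr_le_trajDist {n : ℕ} (hn : n + 2 ≤ H) :
    stepErr θ θ' π P ((Nat.le_succ _).trans hn) ≤ 2 * L * trajDist θ θ' π := by
  have h1 := stepErr_le_add θ θ' π (P := P) ((Nat.le_succ _).trans hn)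
  have h2 := latentDist_le_trajDist θ θ' π hP hL hL0 ((Nat.le_succ _).trans hn)
  have h3 := latentDist_le_trajDist θ θ' π hP hL hL0 hn
  linarith

theorem emErr_le_trajDist {n : ℕ} (hn : n + 1 ≤ H) :
    emErr θ θ' π P ((Nat.le_succ n).trans hn) ≤ (L + 1) * trajDist θ θ' π := by
  have h1 := emErr_le_add θ θ' π (P := P) ((Nat.le_succ _).trans hn)
  have h2 := latentDist_le_trajDist θ θ' π hP hL hL0 hn
  have h3 := obsDist_le_trajDist θ θ' π hn
  linarith

end Past

theorem sum_abs_col (M : Matrix 𝒪 𝒮 ℝ) (hM : ∀ s, ∑ o, |M o s| ≤ 1) (Q : Matrix 𝒮 𝒪 ℝ)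
    (hQ : ∀ v : 𝒪 → ℝ, ∑ s, |(Q *ᵥ v) s| ≤ L * ∑ o, |v o|) (hL0 : 0 ≤ L) (s : 𝒮) :
    ∑ s', |(Q * M) s' s| ≤ L :=
  (hQ fun o => M o s).trans (mul_le_of_le_one_right hL0 (hM s))

theorem abs_le_of_sum_abs_le {ι : Type*} [Fintype ι] {v : ι → ℝ} {C : ℝ} (h : ∑ i, |v i| ≤ C)
    (i : ι) : |v i| ≤ C :=
  (Finset.single_le_sum (f := fun i => |v i|) (fun _ _ => abs_nonneg _) (mem_univ i)).trans h

theorem Params.sum_abs_em (n : ℕ) (s : 𝒮) : ∑ o, |θ.em n o s| ≤ 1 := by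
  simp only [abs_of_nonneg (θ.em_nonneg n _ _), θ.sum_em, le_refl]

theorem Params.em_le_one (n : ℕ) (o : 𝒪) (s : 𝒮) : θ.em n o s ≤ 1 :=
  (le_abs_self _).trans (abs_le_of_sum_abs_le (θ.sum_abs_em n s) o)

theorem Params.sum_abs_step_mulVec_le' (n : ℕ) (x : 𝒪 × 𝒜) (v : 𝒮 → ℝ) :
    ∑ s', |(θ.step n x *ᵥ v) s'| ≤ ∑ s, |v s| := by
  refine (sum_abs_step_mulVec_le θ n x v).trans ?_
  refine Finset.sum_le_sum fun s _ => ?_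
  exact mul_le_of_le_one_left (abs_nonneg _) (θ.em_le_one n _ _)

theorem Params.sum_abs_step (n : ℕ) (x : 𝒪 × 𝒜) (s : 𝒮) : ∑ s', |θ.step n x s' s| ≤ 1 := by
  have h := θ.sum_abs_step_mulVec_le' n x (Pi.single s 1)
  simpa [Pi.single_apply, apply_ite abs] using h

theorem abs_stepGap_le (hL : ∀ n (v : 𝒪 → ℝ), ∑ s, |(P n *ᵥ v) s| ≤ L * ∑ o, |v o|)
    (hL0 : 0 ≤ L) (n : ℕ) (x : 𝒪 × 𝒜) (s' s : 𝒮) : |stepGap θ θ' P n x s' s| ≤ 2 * L := by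
  rw [stepGap, Matrix.sub_apply]
  refine (abs_sub _ _).trans ?_
  rw [two_mul]
  refine add_le_add ?_ ?_
  · refine abs_le_of_sum_abs_le (v := fun s' => (θ.step n x * (P n * θ'.em n)) s' s) ?_ s'
    refine (θ.sum_abs_step_mulVec_le' n x fun i => (P n * θ'.em n) i s).trans ?_
    exact sum_abs_col _ (θ'.sum_abs_em n) _ (hL n) hL0 s
  · refine abs_le_of_sum_abs_le
      (v := fun s' => (P (n + 1) * θ'.em (n + 1) * θ'.step n x) s' s) ?_ s'
    rw [Matrix.mul_assoc]
    refine sum_abs_col _ (fun s => ?_) _ (hL (n + 1)) hL0 s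
    refine le_trans ?_ (θ'.sum_abs_step n x s)
    exact sum_abs_em_mulVec_le θ' (n + 1) fun i => θ'.step n x i s

theorem abs_emGap_le (hL : ∀ n (v : 𝒪 → ℝ), ∑ s, |(P n *ᵥ v) s| ≤ L * ∑ o, |v o|)
    (hL0 : 0 ≤ L) (n : ℕ) (o : 𝒪) (s : 𝒮) : |emGap θ θ' P n o s| ≤ L + 1 := by
  rw [emGap, Matrix.sub_apply]
  refine (abs_sub _ _).trans ?_
  refine add_le_add ?_ (abs_le_of_sum_abs_le (θ'.sum_abs_em n s) o)
  refine abs_le_of_sum_abs_le (v := fun o => (θ.em n * (P n * θ'.em n)) o s) ?_ o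
  refine (sum_abs_em_mulVec_le θ n fun i => (P n * θ'.em n) i s).trans ?_
  exact sum_abs_col _ (θ'.sum_abs_em n) _ (hL n) hL0 s

end Compare

/-! ### From past to current prediction errors -/

section Eluder

variable {H : ℕ} {𝒮 𝒜 𝒪 : Type*} [Fintype 𝒮] [Fintype 𝒜] [Fintype 𝒪] [DecidableEq 𝒮] [NeZero H]

theorem trajDist_le_two (θ θ' : Params H 𝒮 𝒜 𝒪) (π : Policy H 𝒜 𝒪) : trajDist θ θ' π ≤ 2 := by
  calc trajDist θ θ' π ≤ ∑ τ, (trajProb θ π τ + trajProb θ' π τ) := by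
        refine Finset.sum_le_sum fun τ _ => (abs_sub _ _).trans_eq ?_
        rw [abs_of_nonneg (trajProb_nonneg _ _ _), abs_of_nonneg (trajProb_nonneg _ _ _)]
    _ = 2 := by rw [Finset.sum_add_distrib, sum_trajProb, sum_trajProb]; norm_num

/-- Before the first observation no policy is involved. -/
theorem latentDist_zero_eq (θ θ' : Params H 𝒮 𝒜 𝒪) (π π' : Policy H 𝒜 𝒪) (P : ℕ → Matrix 𝒮 𝒪 ℝ) :
    latentDist θ θ' π P (Nat.zero_le H) = latentDist θ θ' π' P (Nat.zero_le H) := by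
  simp [latentDist, Policy.weight]

theorem exists_leftInverse_em {α : ℝ} (hα : 0 < α) {θ : Params H 𝒮 𝒜 𝒪}
    (hθ : WeaklyRevealing α θ) :
    ∃ P : ℕ → Matrix 𝒮 𝒪 ℝ, (∀ n, P n * θ.em n = 1) ∧
      ∀ n (v : 𝒪 → ℝ), ∑ s, |(P n *ᵥ v) s| ≤ √(Fintype.card 𝒮) / α * ∑ o, |v o| := by
  choose P hP using fun n : ℕ =>
    exists_leftInverse_of_singularValues (θ.em n) hα (hθ (Fin.ofNat H n))
  exact ⟨P, fun n => (hP n).1, fun n => (hP n).2⟩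

theorem Policy.weight_snoc_le (π : Policy H 𝒜 𝒪) {n : ℕ} (hn : n + 1 ≤ H) (τ : Traj n 𝒪 𝒜)
    (x : 𝒪 × 𝒜) : π.weight hn (τ.snoc x) ≤ π.weight ((Nat.le_succ n).trans hn) τ := by
  rw [π.weight_snoc]
  refine mul_le_of_le_one_right (π.weight_nonneg _ _) ?_
  rw [← (π.act_mem ⟨n, hn⟩ τ x.1).2]
  exact Finset.single_le_sum (fun a _ => (π.act_mem _ _ _).1 a) (mem_univ _)

/-- The bound of `sum_abs_dotProduct_le` for `S`-dimensional families, with common bounds for the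
functionals and for the past values. -/
noncomputable def eluderBound (S n : ℕ) (R B : ℝ) : ℝ :=
  S * √(n * (2 * (S * R ^ 2 + R ^ 2 * B + R ^ 2) * ((S : ℝ) ^ 2 + S * Real.log (1 + n))))

variable (θ' : Params H 𝒮 𝒜 𝒪) (mod : ℕ → Params H 𝒮 𝒜 𝒪) (pol : ℕ → Policy H 𝒜 𝒪)
  (P : ℕ → ℕ → Matrix 𝒮 𝒪 ℝ) {n : ℕ} {L B : ℝ}

/-- Squared sums of quantities dominated by the distances of the laws. -/
theorem sum_sq_le_of_le_mul {N : ℕ → ℝ} {T : ℕ → ℝ} {k : ℕ} {C : ℝ} (hN0 : ∀ t, 0 ≤ N t)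
    (hN : ∀ t, N t ≤ C * T t) (hB : ∑ t ∈ range k, T t ^ 2 ≤ B) :
    ∑ t ∈ range k, N t ^ 2 ≤ C ^ 2 * B := by
  refine le_trans (Finset.sum_le_sum fun t _ => pow_le_pow_left₀ (hN0 t) (hN t) 2) ?_
  simp only [mul_pow, ← Finset.mul_sum]
  exact mul_le_mul_of_nonneg_left hB (sq_nonneg _)

section Terms

variable (hP : ∀ k < n, ∀ m, P k m * (mod k).em m = 1)
  (hL : ∀ k < n, ∀ m (v : 𝒪 → ℝ), ∑ s, |(P k m *ᵥ v) s| ≤ L * ∑ o, |v o|) (hL0 : 0 ≤ L)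
  (hB : ∀ k < n, ∑ t ∈ range k, trajDist (mod k) θ' (pol t) ^ 2 ≤ B)

include hP hL hL0 hB

/-- The pigeonhole bound for the discrepancies of step `m`, applied to each entry `(x, s)`
separately. The vectors `X x t τ` depend on the executed policy only, the functionals `W x s k` on
the chosen model only. -/
theorem sum_stepErr_le {m : ℕ} (hm : m + 2 ≤ H) :
    ∑ k ∈ range n, stepErr (mod k) θ' (pol k) (P k) (n := m) (by omega) ≤
      Fintype.card (𝒪 × 𝒜) * (Fintype.card 𝒮 *
        eluderBound (Fintype.card 𝒮) n (2 * L + 1) B) := by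
  have hm1 : m + 1 ≤ H := by omega
  have hm0 : m ≤ H := by omega
  let X : 𝒪 × 𝒜 → ℕ → Traj m 𝒪 𝒜 → 𝒮 → ℝ := fun x t τ =>
    (pol t).weight hm1 (τ.snoc x) • θ'.belief m τ
  let W : 𝒪 × 𝒜 → 𝒮 → ℕ → 𝒮 → ℝ := fun x s k s' => stepGap (mod k) θ' (P k) m x s s'
  have hterm : ∀ k t, stepErr (mod k) θ' (pol t) (P k) hm1 =
      ∑ x, ∑ s, ∑ τ, |W x s k ⬝ᵥ X x t τ| := by
    intro k t
    rw [stepErr, Finset.sum_comm]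
    refine Finset.sum_congr rfl fun x _ => ?_
    rw [Finset.sum_comm]
    refine Finset.sum_congr rfl fun τ _ => ?_
    rw [Finset.mul_sum]
    refine Finset.sum_congr rfl fun s _ => ?_
    rw [dotProduct_smul, smul_eq_mul, abs_mul, abs_of_nonneg ((pol t).weight_nonneg _ _)]
    rfl
  have hX : ∀ x t, ∑ τ, ∑ s, |X x t τ s| ≤ 1 := by
    intro x t
    rw [← sum_weight_mul_sum_belief θ' (pol t) hm0]
    refine Finset.sum_le_sum fun τ _ => ?_
    rw [Finset.mul_sum]
    refine Finset.sum_le_sum fun s _ => ?_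
    simp only [X, Pi.smul_apply, smul_eq_mul]
    rw [abs_of_nonneg (mul_nonneg ((pol t).weight_nonneg _ _) (θ'.belief_nonneg _ _))]
    exact mul_le_mul_of_nonneg_right ((pol t).weight_snoc_le hm1 τ x) (θ'.belief_nonneg _ _)
  have hsingle : ∀ x s, ∑ k ∈ range n, ∑ τ, |W x s k ⬝ᵥ X x k τ| ≤
      eluderBound (Fintype.card 𝒮) n (2 * L + 1) B := by
    intro x s
    refine sum_abs_dotProduct_le n (X x) (W x s) (hX x) (fun k hk s' => ?_) fun k hk => ?_
    · exact (abs_stepGap_le (mod k) θ' (hL k hk) hL0 m x s s').trans (by linarith)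
    · refine sum_sq_le_of_le_mul (T := fun t => trajDist (mod k) θ' (pol t))
        (fun t => Finset.sum_nonneg fun _ _ => abs_nonneg _) (fun t => ?_) (hB k hk)
      have h1 := stepErr_le_trajDist (mod k) θ' (pol t) (hP k hk) (hL k hk) hL0 hm
      rw [hterm] at h1
      have h2 : ∑ τ, |W x s k ⬝ᵥ X x t τ| ≤ ∑ x, ∑ s, ∑ τ, |W x s k ⬝ᵥ X x t τ| := by
        have h3 : ∑ τ, |W x s k ⬝ᵥ X x t τ| ≤ ∑ s, ∑ τ, |W x s k ⬝ᵥ X x t τ| :=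
          Finset.single_le_sum (f := fun s => ∑ τ, |W x s k ⬝ᵥ X x t τ|)
            (fun _ _ => Finset.sum_nonneg fun _ _ => abs_nonneg _) (mem_univ s)
        exact h3.trans (Finset.single_le_sum (f := fun x => ∑ s, ∑ τ, |W x s k ⬝ᵥ X x t τ|)
          (fun _ _ => Finset.sum_nonneg fun _ _ => Finset.sum_nonneg fun _ _ => abs_nonneg _)
          (mem_univ x))
      have h4 := trajDist_nonneg (mod k) θ' (pol t)
      nlinarith
  simp only [hterm]
  rw [Finset.sum_comm]
  calc ∑ x, ∑ k ∈ range n, ∑ s, ∑ τ, |W x s k ⬝ᵥ X x k τ|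
      = ∑ x, ∑ s, ∑ k ∈ range n, ∑ τ, |W x s k ⬝ᵥ X x k τ| :=
        Finset.sum_congr rfl fun _ _ => Finset.sum_comm
    _ ≤ ∑ _x : 𝒪 × 𝒜, ∑ _s : 𝒮, eluderBound (Fintype.card 𝒮) n (2 * L + 1) B :=
        Finset.sum_le_sum fun x _ => Finset.sum_le_sum fun s _ => hsingle x s
    _ = _ := by simp

theorem sum_emErr_le {m : ℕ} (hm : m + 1 ≤ H) :
    ∑ k ∈ range n, emErr (mod k) θ' (pol k) (P k) (n := m) (by omega) ≤
      Fintype.card 𝒪 * eluderBound (Fintype.card 𝒮) n (2 * L + 1) B := by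
  have hm0 : m ≤ H := by omega
  let X : ℕ → Traj m 𝒪 𝒜 → 𝒮 → ℝ := fun t τ => (pol t).weight hm0 τ • θ'.belief m τ
  let W : 𝒪 → ℕ → 𝒮 → ℝ := fun o k s' => emGap (mod k) θ' (P k) m o s'
  have hterm : ∀ k t, emErr (mod k) θ' (pol t) (P k) hm0 = ∑ o, ∑ τ, |W o k ⬝ᵥ X t τ| := by
    intro k t
    rw [emErr, Finset.sum_comm]
    refine Finset.sum_congr rfl fun τ _ => ?_
    rw [Finset.mul_sum]
    refine Finset.sum_congr rfl fun s _ => ?_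
    rw [dotProduct_smul, smul_eq_mul, abs_mul, abs_of_nonneg ((pol t).weight_nonneg _ _)]
    rfl
  have hX : ∀ t, ∑ τ, ∑ s, |X t τ s| ≤ 1 := by
    intro t
    rw [← sum_weight_mul_sum_belief θ' (pol t) hm0]
    refine Finset.sum_le_sum fun τ _ => ?_
    rw [Finset.mul_sum]
    refine Finset.sum_le_sum fun s _ => ?_
    simp only [X, Pi.smul_apply, smul_eq_mul]
    rw [abs_of_nonneg (mul_nonneg ((pol t).weight_nonneg _ _) (θ'.belief_nonneg _ _))]
  have hsingle : ∀ o, ∑ k ∈ range n, ∑ τ, |W o k ⬝ᵥ X k τ| ≤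
      eluderBound (Fintype.card 𝒮) n (2 * L + 1) B := by
    intro o
    refine sum_abs_dotProduct_le n X (W o) hX (fun k hk s' => ?_) fun k hk => ?_
    · exact (abs_emGap_le (mod k) θ' (hL k hk) hL0 m o s').trans (by linarith)
    · refine sum_sq_le_of_le_mul (T := fun t => trajDist (mod k) θ' (pol t))
        (fun t => Finset.sum_nonneg fun _ _ => abs_nonneg _) (fun t => ?_) (hB k hk)
      have h1 := emErr_le_trajDist (mod k) θ' (pol t) (hP k hk) (hL k hk) hL0 hm
      rw [hterm] at h1
      have h2 : ∑ τ, |W o k ⬝ᵥ X t τ| ≤ ∑ o, ∑ τ, |W o k ⬝ᵥ X t τ| :=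
        Finset.single_le_sum (f := fun o => ∑ τ, |W o k ⬝ᵥ X t τ|)
          (fun _ _ => Finset.sum_nonneg fun _ _ => abs_nonneg _) (mem_univ o)
      have h4 := trajDist_nonneg (mod k) θ' (pol t)
      nlinarith
  simp only [hterm]
  rw [Finset.sum_comm]
  calc ∑ o, ∑ k ∈ range n, ∑ τ, |W o k ⬝ᵥ X k τ|
      ≤ ∑ _o : 𝒪, eluderBound (Fintype.card 𝒮) n (2 * L + 1) B :=
        Finset.sum_le_sum fun o _ => hsingle o
    _ = _ := by simp

/-- The initial error is the same under all policies, which is the one-dimensional case of the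
pigeonhole bound. -/
theorem sum_latentDist_zero_le :
    ∑ k ∈ range n, latentDist (mod k) θ' (pol k) (P k) (Nat.zero_le H) ≤
      eluderBound 1 n (2 * L + 1) B := by
  let W : ℕ → Unit → ℝ := fun k _ => latentDist (mod k) θ' (pol 0) (P k) (Nat.zero_le H)
  have h0 : ∀ k, 0 ≤ W k () := fun k => Finset.sum_nonneg fun τ _ =>
    mul_nonneg ((pol 0).weight_nonneg _ _) (Finset.sum_nonneg fun _ _ => abs_nonneg _)
  have hW : ∀ k < n, ∀ t, W k () ≤ (2 * L + 1) * trajDist (mod k) θ' (pol t) := by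
    intro k hk t
    have h1 := latentDist_le_trajDist (mod k) θ' (pol t) (hP k hk) (hL k hk) hL0
      (n := 0) (Nat.pos_of_ne_zero (NeZero.ne H))
    rw [latentDist_zero_eq (mod k) θ' (pol t) (pol 0)] at h1
    have h4 := trajDist_nonneg (mod k) θ' (pol t)
    change latentDist _ _ _ _ _ ≤ _
    nlinarith
  have hWR : ∀ k < n, ∀ s, |W k s| ≤ 2 * L + 1 := by
    intro k hk s
    have h1 := latentDist_le_trajDist (mod k) θ' (pol 0) (hP k hk) (hL k hk) hL0
      (n := 0) (Nat.pos_of_ne_zero (NeZero.ne H))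
    have h2 := trajDist_le_two (mod k) θ' (pol 0)
    rw [abs_of_nonneg (h0 k)]
    change latentDist _ _ _ _ _ ≤ _
    nlinarith
  have h := sum_abs_dotProduct_le (J := Unit) n (fun _ _ _ => 1) W (R := 2 * L + 1)
    (B := (2 * L + 1) ^ 2 * B) (by simp) hWR fun k hk => by
      refine sum_sq_le_of_le_mul (T := fun t => trajDist (mod k) θ' (pol t))
        (fun t => Finset.sum_nonneg fun _ _ => abs_nonneg _) (fun t => ?_) (hB k hk)
      simpa [dotProduct, abs_of_nonneg (h0 k)] using hW k hk t
  refine le_trans (le_of_eq ?_) (h.trans_eq ?_)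
  · refine Finset.sum_congr rfl fun k _ => ?_
    rw [latentDist_zero_eq (mod k) θ' (pol k) (pol 0)]
    simp [dotProduct, abs_of_nonneg (h0 k), W]
  · simp [eluderBound]

end Terms

/-- If every model `mod k` predicts the laws of the trajectories under the earlier policies well,
the sum of its errors under the current policies is of order `√n`. -/
theorem sum_trajDist_le {α : ℝ} (hα : 0 < α) (hmod : ∀ k < n, WeaklyRevealing α (mod k))
    (hB0 : 0 ≤ B) (hB : ∀ k < n, ∑ t ∈ range k, trajDist (mod k) θ' (pol t) ^ 2 ≤ B) :
    ∑ k ∈ range n, trajDist (mod k) θ' (pol k) ≤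
      (1 + H * (Fintype.card 𝒪 * Fintype.card 𝒜 * Fintype.card 𝒮) + Fintype.card 𝒪) *
        eluderBound (Fintype.card 𝒮) n (2 * (√(Fintype.card 𝒮) / α) + 1) B := by
  set L := √(Fintype.card 𝒮) / α
  have hL0 : 0 ≤ L := by positivity
  have hex : ∀ k, ∃ P : ℕ → Matrix 𝒮 𝒪 ℝ, k < n → (∀ m, P m * (mod k).em m = 1) ∧
      ∀ m (v : 𝒪 → ℝ), ∑ s, |(P m *ᵥ v) s| ≤ L * ∑ o, |v o| := by
    intro k
    by_cases hk : k < n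
    · obtain ⟨P, h⟩ := exists_leftInverse_em hα (hmod k hk)
      exact ⟨P, fun _ => h⟩
    · exact ⟨0, fun h => absurd h hk⟩
  choose P hP using hex
  obtain ⟨N, hN⟩ : ∃ N, N + 1 = H := ⟨H - 1, Nat.succ_pred_eq_of_ne_zero (NeZero.ne H)⟩
  set E := eluderBound (Fintype.card 𝒮) n (2 * L + 1) B
  have hE0 : 0 ≤ E := by simp only [E, eluderBound]; positivity
  have hS : (1 : ℝ) ≤ Fintype.card 𝒮 := by
    have : Nonempty 𝒮 := by
      by_contra h
      rw [not_nonempty_iff] at h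
      simpa using θ'.init_mem.2
    exact_mod_cast Fintype.card_pos
  have hlog : 0 ≤ Real.log (1 + n) := Real.log_nonneg (by simp)
  have hE1 : eluderBound 1 n (2 * L + 1) B ≤ E := by
    simp only [E, eluderBound, Nat.cast_one]
    gcongr
  have h1 := (sum_latentDist_zero_le θ' mod pol P (fun k hk => (hP k hk).1)
    (fun k hk => (hP k hk).2) hL0 hB).trans hE1
  have h2 := sum_emErr_le θ' mod pol P (fun k hk => (hP k hk).1)
    (fun k hk => (hP k hk).2) hL0 hB (m := N) hN.le
  have h3 : ∀ m : Fin N, _ := fun m => sum_stepErr_le θ' mod pol P (fun k hk => (hP k hk).1)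
    (fun k hk => (hP k hk).2) hL0 hB (m := m) (by omega)
  calc ∑ k ∈ range n, trajDist (mod k) θ' (pol k)
      ≤ ∑ k ∈ range n, (latentDist (mod k) θ' (pol k) (P k) (Nat.zero_le H) +
          ∑ m : Fin N, stepErr (mod k) θ' (pol k) (P k) (n := m) (by omega) +
          emErr (mod k) θ' (pol k) (P k) (n := N) (by omega)) :=
        Finset.sum_le_sum fun k _ => trajDist_le_sum (mod k) θ' (pol k) hN
    _ = ∑ k ∈ range n, latentDist (mod k) θ' (pol k) (P k) (Nat.zero_le H) +
          ∑ m : Fin N, ∑ k ∈ range n, stepErr (mod k) θ' (pol k) (P k) (n := m) (by omega) +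
          ∑ k ∈ range n, emErr (mod k) θ' (pol k) (P k) (n := N) (by omega) := by
        rw [Finset.sum_add_distrib, Finset.sum_add_distrib, Finset.sum_comm]
    _ ≤ E + ∑ _m : Fin N, (Fintype.card (𝒪 × 𝒜) * (Fintype.card 𝒮 * E) : ℝ) +
          Fintype.card 𝒪 * E :=
        add_le_add (add_le_add h1 (Finset.sum_le_sum fun m _ => h3 m)) h2
    _ ≤ _ := by
        simp only [Finset.sum_const, Finset.card_univ, Fintype.card_fin, nsmul_eq_mul,
          Fintype.card_prod, Nat.cast_mul]
        have hNH : (N : ℝ) ≤ H := by exact_mod_cast (by omega : N ≤ H)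
        have h4 : (N : ℝ) * (Fintype.card 𝒪 * Fintype.card 𝒜 * (Fintype.card 𝒮 * E)) ≤
            H * (Fintype.card 𝒪 * Fintype.card 𝒜 * (Fintype.card 𝒮 * E)) := by gcongr
        nlinarith

end Eluder

/-! ### A finite net of models -/

section Net

/-- A probability vector rounded up to multiples of `1 / m` and normalized. -/
noncomputable def roundUp {ι : Type*} [Fintype ι] (m : ℕ) (v : ι → ℝ) : ι → ℝ := fun i =>
  (⌈m * v i⌉₊ : ℝ) / ∑ j, (⌈m * v j⌉₊ : ℝ)

theorem le_sum_ceil {ι : Type*} [Fintype ι] (m : ℕ) {v : ι → ℝ} (hv : v ∈ stdSimplex ℝ ι) :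
    (m : ℝ) ≤ ∑ j, (⌈m * v j⌉₊ : ℝ) := by
  calc (m : ℝ) = ∑ j, m * v j := by rw [← Finset.mul_sum, hv.2, mul_one]
    _ ≤ _ := Finset.sum_le_sum fun j _ => Nat.le_ceil _

theorem sum_ceil_le {ι : Type*} [Fintype ι] (m : ℕ) {v : ι → ℝ} (hv : v ∈ stdSimplex ℝ ι) :
    ∑ j, (⌈m * v j⌉₊ : ℝ) ≤ m + Fintype.card ι := by
  calc ∑ j, (⌈m * v j⌉₊ : ℝ) ≤ ∑ j, (m * v j + 1) := Finset.sum_le_sum fun j _ =>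
        (Nat.ceil_lt_add_one (mul_nonneg (Nat.cast_nonneg _) (hv.1 j))).le
    _ = _ := by rw [Finset.sum_add_distrib, ← Finset.mul_sum, hv.2]; simp

theorem roundUp_mem {ι : Type*} [Fintype ι] {m : ℕ} (hm : 0 < m) {v : ι → ℝ}
    (hv : v ∈ stdSimplex ℝ ι) : roundUp m v ∈ stdSimplex ℝ ι := by
  have h1 : (0 : ℝ) < ∑ j, (⌈m * v j⌉₊ : ℝ) :=
    lt_of_lt_of_le (by exact_mod_cast hm) (le_sum_ceil m hv)
  refine ⟨fun i => div_nonneg (Nat.cast_nonneg _) h1.le, ?_⟩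
  simp only [roundUp]
  rw [← Finset.sum_div, div_self h1.ne']

theorem le_mul_roundUp {ι : Type*} [Fintype ι] {m : ℕ} (hm : 0 < m) {v : ι → ℝ}
    (hv : v ∈ stdSimplex ℝ ι) (i : ι) :
    v i ≤ (1 + Fintype.card ι / m) * roundUp m v i := by
  have hm' : (0 : ℝ) < m := by exact_mod_cast hm
  have h1 : (0 : ℝ) < ∑ j, (⌈m * v j⌉₊ : ℝ) := hm'.trans_le (le_sum_ceil m hv)
  have h2 := sum_ceil_le m hv
  have h3 : m * v i ≤ ⌈m * v i⌉₊ := Nat.le_ceil _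
  have h4 : (1 + Fintype.card ι / m) * roundUp m v i =
      (m + Fintype.card ι) / (∑ j, (⌈m * v j⌉₊ : ℝ)) * (⌈m * v i⌉₊ / m) := by
    simp only [roundUp]
    field_simp
  rw [h4]
  calc v i ≤ ⌈m * v i⌉₊ / m := by rw [le_div_iff₀ hm']; linarith
    _ ≤ _ := le_mul_of_one_le_left (by positivity) (by rwa [one_le_div h1])

theorem ceil_lt_succ {ι : Type*} [Fintype ι] (m : ℕ) {v : ι → ℝ} (hv : v ∈ stdSimplex ℝ ι)
    (i : ι) : ⌈m * v i⌉₊ < m + 1 := by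
  rw [Nat.lt_succ_iff, Nat.ceil_le]
  refine mul_le_of_le_one_right (Nat.cast_nonneg _) ?_
  rw [← hv.2]
  exact Finset.single_le_sum (fun j _ => hv.1 j) (mem_univ i)

variable {H : ℕ} {𝒮 𝒜 𝒪 : Type*} [Fintype 𝒮] [Fintype 𝒜] [Fintype 𝒪]

/-- A model with all its distributions rounded. -/
noncomputable def Params.round (θ : Params H 𝒮 𝒜 𝒪) {m : ℕ} (hm : 0 < m) : Params H 𝒮 𝒜 𝒪 where
  init := roundUp m θ.init
  trans h a s' s := roundUp m (fun s' => θ.trans h a s' s) s'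
  emis h o s := roundUp m (fun o => θ.emis h o s) o
  init_mem := roundUp_mem hm θ.init_mem
  trans_mem h a s := roundUp_mem hm (θ.trans_mem h a s)
  emis_mem h s := roundUp_mem hm (θ.emis_mem h s)

/-- The numerators of the rounded parameters. -/
noncomputable def Params.code (θ : Params H 𝒮 𝒜 𝒪) (m : ℕ) :
    (𝒮 → Fin (m + 1)) × (Fin (H - 1) → 𝒜 → 𝒮 → 𝒮 → Fin (m + 1)) ×
      (Fin H → 𝒮 → 𝒪 → Fin (m + 1)) :=
  (fun s => ⟨_, ceil_lt_succ m θ.init_mem s⟩,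
    fun h a s s' => ⟨_, ceil_lt_succ m (θ.trans_mem h a s) s'⟩,
    fun h s o => ⟨_, ceil_lt_succ m (θ.emis_mem h s) o⟩)

theorem Params.round_eq_of_code_eq {θ θ' : Params H 𝒮 𝒜 𝒪} {m : ℕ} (hm : 0 < m)
    (h : θ.code m = θ'.code m) : θ.round hm = θ'.round hm := by
  simp only [Params.code, Prod.mk.injEq, funext_iff, Fin.mk.injEq] at h
  obtain ⟨h1, h2, h3⟩ := h
  ext : 1
  · funext s; simp only [Params.round, roundUp, h1]
  · funext i a s' s; simp only [Params.round, roundUp, h2]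
  · funext i o s; simp only [Params.round, roundUp, h3]

theorem mul_mul_le_mul_mul {x y z x' y' z' a b c : ℝ} (hx : 0 ≤ x) (hy : 0 ≤ y) (hz : 0 ≤ z)
    (h1 : x ≤ a * x') (h2 : y ≤ b * y') (h3 : z ≤ c * z') :
    x * y * z ≤ a * b * c * (x' * y' * z') := by
  calc x * y * z ≤ (a * x') * (b * y') * (c * z') :=
        mul_le_mul (mul_le_mul h1 h2 hy (hx.trans h1)) h3 hz
          (mul_nonneg (hx.trans h1) (hy.trans h2))
    _ = _ := by ring

variable [NeZero H]

/-- Rounding up and normalizing decreases each probability by at most the factor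
`1 + S / m` or `1 + O / m`, and `2 H` factors enter the probability of a trajectory. -/
theorem trajProb_le_round (θ : Params H 𝒮 𝒜 𝒪) {m : ℕ} (hm : 0 < m) (π : Policy H 𝒜 𝒪)
    (τ : Traj H 𝒪 𝒜) :
    trajProb θ π τ ≤ Real.exp (H * (Fintype.card 𝒮 + Fintype.card 𝒪) / m) *
      trajProb (θ.round hm) π τ := by
  have hm' : (0 : ℝ) < m := by exact_mod_cast hm
  set a : ℝ := 1 + Fintype.card 𝒮 / m
  set b : ℝ := 1 + Fintype.card 𝒪 / m
  have ha : 0 ≤ a := by positivity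
  have hb : 0 ≤ b := by positivity
  have hexp : a * b ^ H * a ^ (H - 1) ≤ Real.exp (H * (Fintype.card 𝒮 + Fintype.card 𝒪) / m) := by
    have h1 : a * b ^ H * a ^ (H - 1) = (a * b) ^ H := by
      rw [mul_pow, mul_right_comm, mul_pow_sub_one (NeZero.ne H)]
    have h2 : a ≤ Real.exp (Fintype.card 𝒮 / m) := by
      simpa [a, add_comm] using Real.add_one_le_exp (Fintype.card 𝒮 / m : ℝ)
    have h3 : b ≤ Real.exp (Fintype.card 𝒪 / m) := by
      simpa [b, add_comm] using Real.add_one_le_exp (Fintype.card 𝒪 / m : ℝ)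
    calc _ = (a * b) ^ H := h1
      _ ≤ (Real.exp (Fintype.card 𝒮 / m) * Real.exp (Fintype.card 𝒪 / m)) ^ H := by gcongr
      _ = _ := by
        rw [← Real.exp_add, ← Real.exp_nat_mul]
        congr 1
        ring
  have hr := trajProb_nonneg (θ.round hm) π τ
  refine le_trans ?_ (mul_le_mul_of_nonneg_right hexp hr)
  rw [trajProb, trajProb, mul_left_comm]
  refine mul_le_mul_of_nonneg_left ?_ (π.weight_nonneg _ _)
  rw [Finset.mul_sum]
  refine Finset.sum_le_sum fun s _ => ?_
  have e1 : θ.init (s 0) ≤ a * (θ.round hm).init (s 0) := le_mul_roundUp hm θ.init_mem _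
  have e2 : ∏ h : Fin H, θ.emis h (τ h).1 (s h) ≤
      b ^ H * ∏ h : Fin H, (θ.round hm).emis h (τ h).1 (s h) := by
    calc _ ≤ ∏ h : Fin H, b * (θ.round hm).emis h (τ h).1 (s h) :=
          Finset.prod_le_prod (fun h _ => (θ.emis_mem h _).1 _)
            fun h _ => le_mul_roundUp hm (θ.emis_mem h (s h)) _
      _ = _ := by rw [Finset.prod_mul_distrib]; simp
  have e3 : ∏ h : Fin (H - 1), θ.trans h (τ ⟨h, by omega⟩).2 (s ⟨h + 1, by omega⟩)
        (s ⟨h, by omega⟩) ≤ a ^ (H - 1) * ∏ h : Fin (H - 1), (θ.round hm).trans h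
          (τ ⟨h, by omega⟩).2 (s ⟨h + 1, by omega⟩) (s ⟨h, by omega⟩) := by
    calc _ ≤ ∏ h : Fin (H - 1), a * (θ.round hm).trans h
          (τ ⟨h, by omega⟩).2 (s ⟨h + 1, by omega⟩) (s ⟨h, by omega⟩) :=
          Finset.prod_le_prod (fun h _ => (θ.trans_mem h _ _).1 _)
            fun h _ => le_mul_roundUp hm (θ.trans_mem h _ _) _
      _ = _ := by rw [Finset.prod_mul_distrib]; simp
  have p1 : 0 ≤ ∏ h : Fin H, θ.emis h (τ h).1 (s h) :=
    Finset.prod_nonneg fun h _ => (θ.emis_mem h _).1 _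
  have p2 : 0 ≤ ∏ h : Fin (H - 1), θ.trans h (τ ⟨h, by omega⟩).2 (s ⟨h + 1, by omega⟩)
      (s ⟨h, by omega⟩) := Finset.prod_nonneg fun h _ => (θ.trans_mem h _ _).1 _
  exact mul_mul_le_mul_mul (θ.init_mem.1 _) p1 p2 e1 e2 e3

/-- Finitely many models dominate all models up to a factor, uniformly in the policy and the
trajectory. -/
theorem exists_net [Nonempty (Params H 𝒮 𝒜 𝒪)] {m : ℕ} (hm : 0 < m) :
    ∃ net : Fin ((m + 1) ^ (Fintype.card 𝒮 + (H - 1) * (Fintype.card 𝒜 * Fintype.card 𝒮 ^ 2) +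
        H * (Fintype.card 𝒮 * Fintype.card 𝒪))) → Params H 𝒮 𝒜 𝒪,
      ∀ θ : Params H 𝒮 𝒜 𝒪, ∃ c, ∀ (π : Policy H 𝒜 𝒪) (τ : Traj H 𝒪 𝒜), trajProb θ π τ ≤
        Real.exp (H * (Fintype.card 𝒮 + Fintype.card 𝒪) / m) * trajProb (net c) π τ := by
  classical
  let T := (𝒮 → Fin (m + 1)) × (Fin (H - 1) → 𝒜 → 𝒮 → 𝒮 → Fin (m + 1)) ×
      (Fin H → 𝒮 → 𝒪 → Fin (m + 1))
  have hcard : Fintype.card T = (m + 1) ^ (Fintype.card 𝒮 +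
      (H - 1) * (Fintype.card 𝒜 * Fintype.card 𝒮 ^ 2) +
        H * (Fintype.card 𝒮 * Fintype.card 𝒪)) := by
    simp only [T, Fintype.card_prod, Fintype.card_fun, Fintype.card_fin, ← pow_mul, ← pow_add]
    congr 1
    ring
  let e := (Fintype.equivFinOfCardEq hcard).symm
  -- `g` chooses any model with the given code; its rounding depends on the code alone.
  let g : T → Params H 𝒮 𝒜 𝒪 := fun c =>
    if h : ∃ θ : Params H 𝒮 𝒜 𝒪, θ.code m = c then h.choose.round hm else Classical.arbitrary _
  refine ⟨fun i => g (e i), fun θ => ⟨e.symm (θ.code m), fun π τ => ?_⟩⟩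
  have hex : ∃ θ' : Params H 𝒮 𝒜 𝒪, θ'.code m = θ.code m := ⟨θ, rfl⟩
  have hg : g (e (e.symm (θ.code m))) = θ.round hm := by
    rw [e.apply_symm_apply]
    simp only [g]
    rw [dif_pos hex]
    exact Params.round_eq_of_code_eq hm hex.choose_spec
  change _ ≤ _ * trajProb (g (e (e.symm (θ.code m)))) π τ
  rw [hg]
  exact trajProb_le_round θ hm π τ

end Net

/-! ### The Hellinger distance and likelihood ratios -/

section Hellinger

variable {H : ℕ} {𝒮 𝒜 𝒪 : Type*} [Fintype 𝒮] [Fintype 𝒜] [Fintype 𝒪] [NeZero H]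

/-- The squared Hellinger distance (without the factor `1/2`) of the trajectory laws of two
models. -/
noncomputable def hellinger (θ θ' : Params H 𝒮 𝒜 𝒪) (π : Policy H 𝒜 𝒪) : ℝ :=
  ∑ τ : Traj H 𝒪 𝒜, (√(trajProb θ π τ) - √(trajProb θ' π τ)) ^ 2

theorem hellinger_nonneg (θ θ' : Params H 𝒮 𝒜 𝒪) (π : Policy H 𝒜 𝒪) : 0 ≤ hellinger θ θ' π :=
  Finset.sum_nonneg fun _ _ => sq_nonneg _

/-- The square root of the likelihood ratio of `θ` against `θ'`, compensated by the Hellinger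
distance so that its mean under `θ'` is at most one. -/
noncomputable def hellingerRatio (θ θ' : Params H 𝒮 𝒜 𝒪) (d : Policy H 𝒜 𝒪 × Traj H 𝒪 𝒜) : ℝ :=
  √(trajProb θ d.1 d.2 / trajProb θ' d.1 d.2) * Real.exp (hellinger θ θ' d.1 / 2)

variable (θ θ' : Params H 𝒮 𝒜 𝒪) (π : Policy H 𝒜 𝒪)

theorem hellingerRatio_nonneg (d : Policy H 𝒜 𝒪 × Traj H 𝒪 𝒜) : 0 ≤ hellingerRatio θ θ' d :=
  mul_nonneg (Real.sqrt_nonneg _) (Real.exp_pos _).le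

theorem sum_mul_hellingerRatio_le :
    ∑ τ, trajProb θ' π τ * hellingerRatio θ θ' (π, τ) ≤ 1 := by
  have h1 : ∀ τ, trajProb θ' π τ * √(trajProb θ π τ / trajProb θ' π τ) =
      √(trajProb θ π τ) * √(trajProb θ' π τ) := by
    intro τ
    have h0 := trajProb_nonneg θ' π τ
    rw [Real.sqrt_div' _ h0]
    -- Where `θ'` gives probability zero, the ratio has the junk value `0`, and both sides vanish.
    rcases h0.eq_or_lt with h | h
    · simp [← h]
    · have : √(trajProb θ' π τ) ≠ 0 := (Real.sqrt_pos.2 h).ne'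
      nth_rewrite 1 [← Real.mul_self_sqrt h0]
      field_simp
  have h2 : ∑ τ, √(trajProb θ π τ) * √(trajProb θ' π τ) = 1 - hellinger θ θ' π / 2 := by
    have h3 : ∀ τ, (√(trajProb θ π τ) - √(trajProb θ' π τ)) ^ 2 =
        trajProb θ π τ + trajProb θ' π τ - 2 * (√(trajProb θ π τ) * √(trajProb θ' π τ)) := by
      intro τ
      rw [sub_sq, Real.sq_sqrt (trajProb_nonneg _ _ _), Real.sq_sqrt (trajProb_nonneg _ _ _)]
      ring
    rw [hellinger]
    simp only [h3]
    rw [Finset.sum_sub_distrib, Finset.sum_add_distrib, sum_trajProb, sum_trajProb,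
      ← Finset.mul_sum]
    ring
  simp only [hellingerRatio, ← mul_assoc, h1]
  rw [← Finset.sum_mul, h2]
  have h4 : 1 - hellinger θ θ' π / 2 ≤ Real.exp (-(hellinger θ θ' π / 2)) := by
    have := Real.add_one_le_exp (-(hellinger θ θ' π / 2))
    linarith
  calc _ ≤ Real.exp (-(hellinger θ θ' π / 2)) * Real.exp (hellinger θ θ' π / 2) := by gcongr
    _ = 1 := by rw [← Real.exp_add]; simp

theorem trajDist_sq_le_hellinger : trajDist θ θ' π ^ 2 ≤ 4 * hellinger θ θ' π := by
  have h1 : trajDist θ θ' π = ∑ τ, |√(trajProb θ π τ) - √(trajProb θ' π τ)| *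
      (√(trajProb θ π τ) + √(trajProb θ' π τ)) := by
    refine Finset.sum_congr rfl fun τ _ => ?_
    rw [← abs_of_nonneg (add_nonneg (Real.sqrt_nonneg (trajProb θ π τ))
      (Real.sqrt_nonneg (trajProb θ' π τ))), ← abs_mul]
    congr 1
    have e1 := Real.mul_self_sqrt (trajProb_nonneg θ π τ)
    have e2 := Real.mul_self_sqrt (trajProb_nonneg θ' π τ)
    nlinarith
  rw [h1]
  refine (Finset.sum_mul_sq_le_sq_mul_sq _ _ _).trans ?_
  simp only [sq_abs]
  rw [mul_comm]
  refine mul_le_mul_of_nonneg_right ?_ (hellinger_nonneg θ θ' π)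
  calc ∑ τ, (√(trajProb θ π τ) + √(trajProb θ' π τ)) ^ 2
      ≤ ∑ τ, 2 * (trajProb θ π τ + trajProb θ' π τ) := by
        refine Finset.sum_le_sum fun τ _ => ?_
        have e1 := Real.sq_sqrt (trajProb_nonneg θ π τ)
        have e2 := Real.sq_sqrt (trajProb_nonneg θ' π τ)
        nlinarith [sq_nonneg (√(trajProb θ π τ) - √(trajProb θ' π τ))]
    _ = 4 := by
        rw [← Finset.mul_sum, Finset.sum_add_distrib, sum_trajProb, sum_trajProb]; norm_num

/-- Two laws, one of which dominates the other up to a factor near one, are close. -/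
theorem trajDist_le_of_le_exp {t : ℝ} (ht0 : 0 ≤ t) (ht1 : t ≤ 1)
    (h : ∀ τ, trajProb θ π τ ≤ Real.exp t * trajProb θ' π τ) : trajDist θ θ' π ≤ 4 * t := by
  have h1 : 1 ≤ Real.exp t := Real.one_le_exp ht0
  have h2 : Real.exp t ≤ 1 + 2 * t := by
    have := Real.abs_exp_sub_one_le (x := t) (by rwa [abs_of_nonneg ht0])
    rw [abs_of_nonneg (by linarith), abs_of_nonneg ht0] at this
    linarith
  calc trajDist θ θ' π
      ≤ ∑ τ, ((Real.exp t * trajProb θ' π τ - trajProb θ π τ) +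
          (Real.exp t - 1) * trajProb θ' π τ) := by
        refine Finset.sum_le_sum fun τ _ => ?_
        have h3 := trajProb_nonneg θ' π τ
        have h4 := h τ
        rw [abs_le]
        constructor <;> nlinarith
    _ = 2 * (Real.exp t - 1) := by
        rw [Finset.sum_add_distrib, Finset.sum_sub_distrib, ← Finset.mul_sum, ← Finset.mul_sum,
          sum_trajProb, sum_trajProb]
        ring
    _ ≤ 4 * t := by linarith

theorem trajDist_triangle (θ'' : Params H 𝒮 𝒜 𝒪) :
    trajDist θ θ'' π ≤ trajDist θ θ' π + trajDist θ' θ'' π := by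
  rw [trajDist, trajDist, trajDist, ← Finset.sum_add_distrib]
  exact Finset.sum_le_sum fun τ _ => abs_sub_le _ _ _

/-- The likelihood `∏_{(π,τ) ∈ D} ℙ^π_θ(τ)`. -/
def lik (D : Data H 𝒜 𝒪) : ℝ := (D.map fun d => trajProb θ d.1 d.2).prod

theorem lik_nonneg (D : Data H 𝒜 𝒪) : 0 ≤ lik θ D := by
  refine List.prod_nonneg fun x hx => ?_
  obtain ⟨d, _, rfl⟩ := List.mem_map.1 hx
  exact trajProb_nonneg _ _ _

theorem lik_cons (d : Policy H 𝒜 𝒪 × Traj H 𝒪 𝒜) (D : Data H 𝒜 𝒪) :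
    lik θ (d :: D) = trajProb θ d.1 d.2 * lik θ D := by simp [lik]

theorem logLik_eq_log_lik (D : Data H 𝒜 𝒪) :
    logLik θ D = ENNReal.log (ENNReal.ofReal (lik θ D)) := by
  induction D with
  | nil => simp [logLik, lik]
  | cons d D ih =>
    rw [lik_cons, ENNReal.ofReal_mul (trajProb_nonneg _ _ _), ENNReal.log_mul_add, ← ih]
    simp [logLik]

theorem logLik_le_add_iff (D : Data H 𝒜 𝒪) (β : ℝ) :
    logLik θ D ≤ logLik θ' D + β ↔ lik θ D ≤ Real.exp β * lik θ' D := by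
  have h : (β : EReal) = ENNReal.log (ENNReal.ofReal (Real.exp β)) := by
    rw [ENNReal.log_ofReal_of_pos (Real.exp_pos _), Real.log_exp]
  rw [logLik_eq_log_lik, logLik_eq_log_lik, h, ← ENNReal.log_mul_add, ENNReal.log_le_log_iff,
    ← ENNReal.ofReal_mul (lik_nonneg _ _), mul_comm]
  exact ENNReal.ofReal_le_ofReal_iff (mul_nonneg (Real.exp_pos _).le (lik_nonneg _ _))

/-- The confidence set in terms of likelihoods instead of extended-real logarithms. -/
theorem mem_confSet_iff [DecidableEq 𝒮] {α β : ℝ} {D : Data H 𝒜 𝒪} :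
    θ ∈ (confSet α β D : Set (Params H 𝒮 𝒜 𝒪)) ↔ WeaklyRevealing α θ ∧
      ∀ θ' : Params H 𝒮 𝒜 𝒪, lik θ' D ≤ Real.exp β * lik θ D := by
  simp only [confSet, Set.mem_ofPred_eq, ← logLik_le_add_iff]
  rw [EReal.sub_le_iff_le_add (Or.inl (EReal.coe_ne_bot β)) (Or.inl (EReal.coe_ne_top β)),
    iSup_le_iff]

theorem lik_le_of_le_exp {t : ℝ}
    (h : ∀ (π : Policy H 𝒜 𝒪) (τ : Traj H 𝒪 𝒜), trajProb θ π τ ≤ Real.exp t * trajProb θ' π τ)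
    (D : Data H 𝒜 𝒪) : lik θ D ≤ Real.exp (D.length * t) * lik θ' D := by
  induction D with
  | nil => simp [lik]
  | cons d D ih =>
    rw [lik_cons, lik_cons]
    refine (mul_le_mul (h d.1 d.2) ih (lik_nonneg _ _)
      (mul_nonneg (Real.exp_pos _).le (trajProb_nonneg _ _ _))).trans_eq ?_
    rw [List.length_cons, Nat.cast_succ, add_mul, Real.exp_add, one_mul]
    ring

theorem prod_hellingerRatio_sq (D : Data H 𝒜 𝒪) (hD : ∀ d ∈ D, 0 < trajProb θ' d.1 d.2) :
    (D.map (hellingerRatio θ θ')).prod ^ 2 * lik θ' D =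
      lik θ D * Real.exp ((D.map fun d => hellinger θ θ' d.1).sum) := by
  induction D with
  | nil => simp [lik]
  | cons d D ih =>
    have h1 := ih fun d' hd' => hD d' (List.mem_cons_of_mem _ hd')
    have hd : 0 < trajProb θ' d.1 d.2 := hD d List.mem_cons_self
    rw [lik_cons, lik_cons, List.map_cons, List.prod_cons, List.map_cons, List.sum_cons,
      Real.exp_add]
    have h2 : hellingerRatio θ θ' d ^ 2 * trajProb θ' d.1 d.2 =
        trajProb θ d.1 d.2 * Real.exp (hellinger θ θ' d.1) := by
      rw [hellingerRatio, mul_pow, Real.sq_sqrt (div_nonneg (trajProb_nonneg _ _ _) hd.le),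
        ← Real.exp_nat_mul, Nat.cast_ofNat, mul_div_cancel₀ _ (two_ne_zero)]
      field_simp
    calc _ = (hellingerRatio θ θ' d ^ 2 * trajProb θ' d.1 d.2) *
          ((D.map (hellingerRatio θ θ')).prod ^ 2 * lik θ' D) := by ring
      _ = _ := by rw [h1, h2]; ring

end Hellinger

/-! ### The law of the data -/

section Run

variable {H : ℕ} {𝒮 𝒜 𝒪 : Type*} [Fintype 𝒮] [Fintype 𝒜] [Fintype 𝒪] [NeZero H]
  (θ : Params H 𝒮 𝒜 𝒪) (alg : Data H 𝒜 𝒪 → Params H 𝒮 𝒜 𝒪 × Policy H 𝒜 𝒪)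

theorem trajLaw_apply (π : Policy H 𝒜 𝒪) (τ : Traj H 𝒪 𝒜) :
    trajLaw θ π τ = ENNReal.ofReal (trajProb θ π τ) := rfl

/-- A nonnegative supermartingale has nonincreasing means. -/
theorem tsum_runLaw_mul_le {F : Data H 𝒜 𝒪 → ℝ≥0∞} {C : ℝ≥0∞} (h0 : F [] ≤ C)
    (hstep : ∀ D, ∑ τ, trajLaw θ (alg D).2 τ * F (D ++ [((alg D).2, τ)]) ≤ F D) (k : ℕ) :
    ∑' D, runLaw θ alg k D * F D ≤ C := by
  induction k with
  | zero =>
    rw [runLaw, tsum_eq_single []]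
    · simpa using h0
    · intro D hD
      simp [PMF.pure_apply, hD]
  | succ k ih =>
    refine le_trans ?_ ih
    rw [runLaw]
    simp only [PMF.bind_apply, ← ENNReal.tsum_mul_right]
    rw [ENNReal.tsum_comm]
    refine ENNReal.tsum_le_tsum fun D => ?_
    simp only [mul_assoc]
    rw [ENNReal.tsum_mul_left]
    gcongr
    refine le_trans (le_of_eq ?_) (hstep D)
    simp only [PMF.map, PMF.bind_apply, Function.comp_apply, ← ENNReal.tsum_mul_right]
    rw [ENNReal.tsum_comm, tsum_fintype]
    refine Finset.sum_congr rfl fun τ _ => ?_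
    rw [tsum_eq_single (D ++ [((alg D).2, τ)])]
    · simp
    · intro D' hD'
      simp [PMF.pure_apply, hD']

/-- A property of the data that survives each possible episode holds almost surely. -/
theorem runLaw_induction {Q : ℕ → Data H 𝒜 𝒪 → Prop} (h0 : Q 0 [])
    (hstep : ∀ k D τ, Q k D → 0 < trajProb θ (alg D).2 τ → Q (k + 1) (D ++ [((alg D).2, τ)]))
    (k : ℕ) : ∀ D ∈ (runLaw θ alg k).support, Q k D := by
  induction k with
  | zero =>
    intro D hD
    rw [runLaw, PMF.mem_support_pure_iff] at hD
    rwa [hD]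
  | succ k ih =>
    intro D hD
    rw [runLaw, PMF.mem_support_bind_iff] at hD
    obtain ⟨D', hD', h⟩ := hD
    rw [PMF.mem_support_map_iff] at h
    obtain ⟨τ, hτ, rfl⟩ := h
    refine hstep k D' τ (ih D' hD') ?_
    rw [PMF.mem_support_iff, trajLaw_apply] at hτ
    by_contra hneg
    exact hτ (ENNReal.ofReal_eq_zero.2 (not_lt.1 hneg))

theorem length_of_mem_support {k : ℕ} {D : Data H 𝒜 𝒪} (hD : D ∈ (runLaw θ alg k).support) :
    D.length = k :=
  runLaw_induction θ alg (Q := fun k D => D.length = k) rfl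
    (fun k D τ h _ => by simp [h]) k D hD

theorem trajProb_pos_of_mem_support {k : ℕ} {D : Data H 𝒜 𝒪}
    (hD : D ∈ (runLaw θ alg k).support) : ∀ d ∈ D, 0 < trajProb θ d.1 d.2 :=
  runLaw_induction θ alg (Q := fun _ D => ∀ d ∈ D, 0 < trajProb θ d.1 d.2) (by simp)
    (fun k D τ h hτ d hd => by
      rcases List.mem_append.1 hd with hd | hd
      · exact h d hd
      · rw [List.mem_singleton.1 hd]; exact hτ) k D hD

/-- Sums over the data of a function of the executed policies. -/
theorem sum_map_take_of_mem_support {k : ℕ} {D : Data H 𝒜 𝒪}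
    (hD : D ∈ (runLaw θ alg k).support) (g : Policy H 𝒜 𝒪 → ℝ) :
    ∀ j ≤ k, ((D.take j).map fun d => g d.1).sum =
      ∑ i ∈ Finset.range j, g (alg (D.take i)).2 := by
  refine (runLaw_induction θ alg (Q := fun k D => D.length = k ∧ ∀ j ≤ k,
    ((D.take j).map fun d => g d.1).sum = ∑ i ∈ Finset.range j, g (alg (D.take i)).2)
    ⟨rfl, fun j hj => ?_⟩ (fun k D τ h _ => ⟨by simp [h.1], fun j hj => ?_⟩) k D hD).2
  · rw [Nat.le_zero.1 hj]; simp
  · obtain ⟨hlen, h⟩ := h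
    have hsum : ∀ j ≤ k, ∑ i ∈ Finset.range j, g (alg ((D ++ [((alg D).2, τ)]).take i)).2 =
        ∑ i ∈ Finset.range j, g (alg (D.take i)).2 := by
      intro j hj
      refine Finset.sum_congr rfl fun i hi => ?_
      rw [List.take_append_of_le_length (by have := Finset.mem_range.1 hi; omega)]
    rcases Nat.lt_or_ge k j with hkj | hkj
    · obtain rfl : j = k + 1 := by omega
      rw [Finset.sum_range_succ, hsum k le_rfl, List.take_append_of_le_length hlen.ge,
        ← h k le_rfl, List.take_of_length_le (by simp [hlen]), ← hlen, List.take_length]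
      simp
    · rw [hsum j hkj, List.take_append_of_le_length (by omega), h j hkj]

/-- Markov's inequality for finitely many nonnegative processes of mean at most one. -/
theorem le_toOuterMeasure_of_supermartingale {I : Type*} [Fintype I]
    (F : I → Data H 𝒜 𝒪 → ℝ) (K : ℕ) {C : ℝ}
    (hC : 0 < C) {δ : ℝ} (hNC : (Fintype.card I : ℝ) / C ≤ δ)
    (hF0 : ∀ c, F c [] ≤ 1) (hF : ∀ c D, 0 ≤ F c D)
    (hstep : ∀ c D, ∑ τ, trajProb θ (alg D).2 τ * F c (D ++ [((alg D).2, τ)]) ≤ F c D)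
    {S : Set (Data H 𝒜 𝒪)}
    (hS : ∀ D ∈ (runLaw θ alg K).support, (∀ c, F c D ≤ C) → D ∈ S) :
    ENNReal.ofReal (1 - δ) ≤ (runLaw θ alg K).toOuterMeasure S := by
  set μ := runLaw θ alg K
  set bad : Set (Data H 𝒜 𝒪) := {D | ∃ c, C < F c D}
  have hmean : ∀ c, ∑' D, μ D * ENNReal.ofReal (F c D) ≤ 1 := by
    intro c
    refine tsum_runLaw_mul_le θ alg (ENNReal.ofReal_le_one.2 (hF0 c)) (fun D => ?_) K
    simp only [trajLaw_apply, ← ENNReal.ofReal_mul (trajProb_nonneg _ _ _)]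
    rw [← ENNReal.ofReal_sum_of_nonneg fun τ _ => mul_nonneg (trajProb_nonneg _ _ _) (hF c _)]
    exact ENNReal.ofReal_le_ofReal (hstep c D)
  have hbad : μ.toOuterMeasure bad ≤ ENNReal.ofReal δ := by
    rw [PMF.toOuterMeasure_apply]
    calc ∑' D, bad.indicator μ D
        ≤ ∑' D, ∑ c, ENNReal.ofReal C⁻¹ * (μ D * ENNReal.ofReal (F c D)) := by
          refine ENNReal.tsum_le_tsum fun D => ?_
          by_cases hD : D ∈ bad
          · rw [Set.indicator_of_mem hD]
            obtain ⟨c, hc⟩ := hD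
            refine le_trans ?_ (Finset.single_le_sum (f := fun c => ENNReal.ofReal C⁻¹ *
              (μ D * ENNReal.ofReal (F c D))) (fun _ _ => zero_le) (mem_univ c))
            rw [mul_left_comm, ← ENNReal.ofReal_mul (by positivity)]
            refine le_mul_of_one_le_right zero_le ?_
            rw [ENNReal.one_le_ofReal, inv_mul_eq_div, one_le_div hC]
            exact hc.le
          · rw [Set.indicator_of_notMem hD]
            exact zero_le
      _ = ∑ c, ENNReal.ofReal C⁻¹ * ∑' D, μ D * ENNReal.ofReal (F c D) := by
          rw [Summable.tsum_finsetSum fun _ _ => ENNReal.summable]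
          simp only [ENNReal.tsum_mul_left]
      _ ≤ ∑ _c : I, ENNReal.ofReal C⁻¹ * 1 := by
          gcongr with c
          exact hmean c
      _ = ENNReal.ofReal (Fintype.card I / C) := by
          rw [div_eq_mul_inv, ENNReal.ofReal_mul (Nat.cast_nonneg _)]
          simp
      _ ≤ ENNReal.ofReal δ := ENNReal.ofReal_le_ofReal hNC
  have htot : (1 : ℝ≥0∞) ≤ μ.toOuterMeasure S + μ.toOuterMeasure bad := by
    have h1 : μ.toOuterMeasure (S ∪ bad) = 1 := by
      rw [PMF.toOuterMeasure_apply_eq_one_iff]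
      intro D hD
      by_cases hb : D ∈ bad
      · exact Or.inr hb
      · refine Or.inl (hS D hD fun c => ?_)
        by_contra hc
        exact hb ⟨c, not_le.1 hc⟩
    rw [← h1]
    exact MeasureTheory.measure_union_le _ _
  rw [ENNReal.ofReal_sub _ (le_trans (by positivity) hNC), ENNReal.ofReal_one]
  exact tsub_le_iff_right.2 (htot.trans (add_le_add le_rfl hbad))

end Run

/-! ### The confidence sets -/

section Confidence

variable {H : ℕ} {𝒮 𝒜 𝒪 : Type*} [Fintype 𝒮] [Fintype 𝒜] [Fintype 𝒪] [NeZero H]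
  (θ : Params H 𝒮 𝒜 𝒪)

/-- The likelihood ratios of finitely many models are, with high probability, bounded by the
number of models and prefixes over `δ`, along all prefixes of the data. -/
theorem le_toOuterMeasure_of_prod_hellingerRatio_le
    (alg : Data H 𝒜 𝒪 → Params H 𝒮 𝒜 𝒪 × Policy H 𝒜 𝒪) {N K : ℕ} (hN : 0 < N) (hK : 0 < K)
    (net : Fin N → Params H 𝒮 𝒜 𝒪) {δ : ℝ} (hδ : 0 < δ) {S : Set (Data H 𝒜 𝒪)}
    (hS : ∀ D ∈ (runLaw θ alg K).support,
      (∀ c, ∀ k < K, ((D.take k).map (hellingerRatio (net c) θ)).prod ≤ N * (K / δ)) → D ∈ S) :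
    ENNReal.ofReal (1 - δ) ≤ (runLaw θ alg K).toOuterMeasure S := by
  have hN' : (0 : ℝ) < N := by exact_mod_cast hN
  have hK' : (0 : ℝ) < K := by exact_mod_cast hK
  refine le_toOuterMeasure_of_supermartingale θ alg (I := Fin N × Fin K)
    (fun c D => ((D.take c.2).map (hellingerRatio (net c.1) θ)).prod) K
    (C := N * (K / δ)) (by positivity) (δ := δ) ?_ (by simp) ?_ ?_ ?_
  · simp only [Fintype.card_prod, Fintype.card_fin, Nat.cast_mul]
    apply le_of_eq
    field_simp
  · intro c D
    refine List.prod_nonneg fun x hx => ?_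
    obtain ⟨d, _, rfl⟩ := List.mem_map.1 hx
    exact hellingerRatio_nonneg _ _ _
  · intro c D
    have hnn : 0 ≤ ((D.take c.2).map (hellingerRatio (net c.1) θ)).prod := by
      refine List.prod_nonneg fun x hx => ?_
      obtain ⟨d, _, rfl⟩ := List.mem_map.1 hx
      exact hellingerRatio_nonneg _ _ _
    -- The process is frozen as soon as its prefix is complete.
    rcases le_or_gt (c.2 : ℕ) D.length with h | h
    · simp only [List.take_append_of_le_length h]
      rw [← Finset.sum_mul, sum_trajProb, one_mul]
    · have h1 : ∀ τ, (D ++ [((alg D).2, τ)]).take c.2 = D.take c.2 ++ [((alg D).2, τ)] := by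
        intro τ
        rw [List.take_of_length_le (by simp; omega), List.take_of_length_le h.le]
      simp only [h1, List.map_append, List.prod_append, List.map_cons, List.map_nil,
        List.prod_singleton]
      simp only [mul_left_comm (trajProb _ _ _)]
      rw [← Finset.mul_sum]
      exact mul_le_of_le_one_right hnn (sum_mul_hellingerRatio_le (net c.1) θ (alg D).2)
  · intro D hD h
    exact hS D hD fun c k hk => h (c, ⟨k, hk⟩)

variable {θ} {N K : ℕ} {net : Fin N → Params H 𝒮 𝒜 𝒪} {C β : ℝ} {D : Data H 𝒜 𝒪}

/-- The bound on a compensated likelihood ratio, with the denominators cleared. -/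
theorem lik_mul_exp_le (hD : ∀ d ∈ D, 0 < trajProb θ d.1 d.2) (c : Fin N)
    (hc : (D.map (hellingerRatio (net c) θ)).prod ≤ C) :
    lik (net c) D * Real.exp ((D.map fun d => hellinger (net c) θ d.1).sum) ≤ C ^ 2 * lik θ D := by
  rw [← prod_hellingerRatio_sq (net c) θ D hD]
  refine mul_le_mul_of_nonneg_right (pow_le_pow_left₀ ?_ hc 2) (lik_nonneg _ _)
  refine List.prod_nonneg fun x hx => ?_
  obtain ⟨d, _, rfl⟩ := List.mem_map.1 hx
  exact hellingerRatio_nonneg _ _ _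

theorem sum_hellinger_nonneg (θ' : Params H 𝒮 𝒜 𝒪) :
    0 ≤ (D.map fun d => hellinger θ' θ d.1).sum := by
  refine List.sum_nonneg fun x hx => ?_
  obtain ⟨d, _, rfl⟩ := List.mem_map.1 hx
  exact hellinger_nonneg _ _ _

theorem lik_le_exp_one_mul (hK : 0 < K) (hlen : D.length ≤ K) {θ' θ'' : Params H 𝒮 𝒜 𝒪}
    (h : ∀ (π : Policy H 𝒜 𝒪) (τ : Traj H 𝒪 𝒜),
      trajProb θ' π τ ≤ Real.exp (1 / K) * trajProb θ'' π τ) :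
    lik θ' D ≤ Real.exp 1 * lik θ'' D := by
  refine (lik_le_of_le_exp θ' θ'' h D).trans ?_
  refine mul_le_mul_of_nonneg_right (Real.exp_le_exp.2 ?_) (lik_nonneg _ _)
  rw [mul_one_div, div_le_one (by exact_mod_cast hK)]
  exact_mod_cast hlen

variable (hK : 0 < K) (hlen : D.length ≤ K) (hD : ∀ d ∈ D, 0 < trajProb θ d.1 d.2)
  (hnet : ∀ θ' : Params H 𝒮 𝒜 𝒪, ∃ c, ∀ (π : Policy H 𝒜 𝒪) (τ : Traj H 𝒪 𝒜),
    trajProb θ' π τ ≤ Real.exp (1 / K) * trajProb (net c) π τ)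
  (hC : 0 < C) (hc : ∀ c, (D.map (hellingerRatio (net c) θ)).prod ≤ C)
  (hβ : 1 + 2 * Real.log C ≤ β)

include hK hlen hD hnet hC hc hβ

/-- The true model has nearly maximal likelihood. -/
theorem lik_le_exp_mul_lik (θ' : Params H 𝒮 𝒜 𝒪) : lik θ' D ≤ Real.exp β * lik θ D := by
  obtain ⟨c, hcθ⟩ := hnet θ'
  have h1 := lik_le_exp_one_mul (D := D) hK hlen hcθ
  have h2 := lik_mul_exp_le hD c (hc c)
  have h3 : lik (net c) D ≤
      lik (net c) D * Real.exp ((D.map fun d => hellinger (net c) θ d.1).sum) :=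
    le_mul_of_one_le_right (lik_nonneg _ _) (Real.one_le_exp (sum_hellinger_nonneg _))
  have h4 : Real.exp 1 * C ^ 2 ≤ Real.exp β := by
    have : C ^ 2 = Real.exp (2 * Real.log C) := by
      rw [mul_comm, ← Real.rpow_def_of_pos hC, Real.rpow_two]
    rw [this, ← Real.exp_add]
    exact Real.exp_le_exp.2 hβ
  calc lik θ' D ≤ Real.exp 1 * (C ^ 2 * lik θ D) :=
        h1.trans (mul_le_mul_of_nonneg_left (h3.trans h2) (Real.exp_pos _).le)
    _ = (Real.exp 1 * C ^ 2) * lik θ D := by ring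
    _ ≤ _ := mul_le_mul_of_nonneg_right h4 (lik_nonneg _ _)

/-- A model of nearly maximal likelihood predicts the laws of the data well. -/
theorem sum_trajDist_sq_le_of_lik_le {θ' : Params H 𝒮 𝒜 𝒪}
    (hθ' : lik θ D ≤ Real.exp β * lik θ' D) :
    (D.map fun d => trajDist θ' θ d.1 ^ 2).sum ≤ 32 + 16 * β := by
  obtain ⟨c, hcθ⟩ := hnet θ'
  have hpos : 0 < lik θ D := by
    refine List.prod_pos fun x hx => ?_
    obtain ⟨d, hd, rfl⟩ := List.mem_map.1 hx
    exact hD d hd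
  have h1 := lik_le_exp_one_mul (D := D) hK hlen hcθ
  have h2 := lik_mul_exp_le hD c (hc c)
  set h := (D.map fun d => hellinger (net c) θ d.1).sum
  have hCsq : C ^ 2 = Real.exp (2 * Real.log C) := by
    rw [mul_comm, ← Real.rpow_def_of_pos hC, Real.rpow_two]
  have h3 : Real.exp h * lik θ D ≤ Real.exp (β + 1 + 2 * Real.log C) * lik θ D := by
    calc Real.exp h * lik θ D ≤ Real.exp h * (Real.exp β * (Real.exp 1 * lik (net c) D)) := by
          gcongr
          exact hθ'.trans (mul_le_mul_of_nonneg_left h1 (Real.exp_pos _).le)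
      _ = Real.exp β * Real.exp 1 * (lik (net c) D * Real.exp h) := by ring
      _ ≤ Real.exp β * Real.exp 1 * (C ^ 2 * lik θ D) := by gcongr
      _ = _ := by rw [hCsq, Real.exp_add, Real.exp_add]; ring
  have h4 : h ≤ 2 * β := by
    have := Real.exp_le_exp.1 (le_of_mul_le_mul_right h3 hpos)
    linarith
  have hK' : (1 : ℝ) ≤ K := by exact_mod_cast hK
  have hstep : ∀ π : Policy H 𝒜 𝒪,
      trajDist θ' θ π ^ 2 ≤ 32 * (1 / K) + 8 * hellinger (net c) θ π := by
    intro π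
    have e1 := trajDist_le_of_le_exp θ' (net c) π (t := 1 / K) (by positivity)
      (by rwa [div_le_one (by positivity)]) (hcθ π)
    have e2 := trajDist_triangle θ' (net c) π θ
    have e3 := trajDist_sq_le_hellinger (net c) θ π
    have e4 := trajDist_nonneg θ' θ π
    have e5 : (1 / K : ℝ) ≤ 1 := by rwa [div_le_one (by positivity)]
    have e6 : (0 : ℝ) ≤ 1 / K := by positivity
    have e7 : trajDist θ' θ π ^ 2 ≤ (4 * (1 / K) + trajDist (net c) θ π) ^ 2 :=
      pow_le_pow_left₀ e4 (e2.trans (by linarith)) 2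
    nlinarith [sq_nonneg (4 * (1 / K : ℝ) - trajDist (net c) θ π)]
  have hsum : ∀ E : Data H 𝒜 𝒪, (E.map fun d => trajDist θ' θ d.1 ^ 2).sum ≤
      E.length * (32 * (1 / K)) + 8 * (E.map fun d => hellinger (net c) θ d.1).sum := by
    intro E
    induction E with
    | nil => simp
    | cons d E ih =>
      simp only [List.map_cons, List.sum_cons, List.length_cons, Nat.cast_succ]
      have := hstep d.1
      linarith
  have h5 : (D.length : ℝ) * (32 * (1 / K)) ≤ 32 := by
    have : (D.length : ℝ) ≤ K := by exact_mod_cast hlen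
    calc (D.length : ℝ) * (32 * (1 / K)) ≤ K * (32 * (1 / K)) := by gcongr
      _ = 32 := by field_simp
  have := hsum D
  linarith

end Confidence

/-! ### Values and regret -/

section Regret

variable {H : ℕ} {𝒮 𝒜 𝒪 : Type*} [Fintype 𝒮] [Fintype 𝒜] [Fintype 𝒪] [NeZero H]
  {r : Fin H → 𝒪 → ℝ} (hr : ∀ h o, r h o ∈ Set.Icc (0 : ℝ) 1)

include hr

theorem sum_reward_mem (τ : Traj H 𝒪 𝒜) : ∑ h : Fin H, r h (τ h).1 ∈ Set.Icc (0 : ℝ) H := by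
  refine ⟨Finset.sum_nonneg fun h _ => (hr h _).1, ?_⟩
  calc ∑ h : Fin H, r h (τ h).1 ≤ ∑ _h : Fin H, (1 : ℝ) := Finset.sum_le_sum fun h _ => (hr h _).2
    _ = H := by simp

theorem value_mem (θ : Params H 𝒮 𝒜 𝒪) (π : Policy H 𝒜 𝒪) : value r θ π ∈ Set.Icc (0 : ℝ) H := by
  refine ⟨Finset.sum_nonneg fun τ _ =>
    mul_nonneg (trajProb_nonneg _ _ _) (sum_reward_mem hr τ).1, ?_⟩
  calc value r θ π ≤ ∑ τ, trajProb θ π τ * H := Finset.sum_le_sum fun τ _ =>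
        mul_le_mul_of_nonneg_left (sum_reward_mem hr τ).2 (trajProb_nonneg _ _ _)
    _ = H := by rw [← Finset.sum_mul, sum_trajProb, one_mul]

theorem value_sub_value_le (θ θ' : Params H 𝒮 𝒜 𝒪) (π : Policy H 𝒜 𝒪) :
    value r θ π - value r θ' π ≤ H * trajDist θ θ' π := by
  rw [value, value, ← Finset.sum_sub_distrib, trajDist, Finset.mul_sum]
  refine Finset.sum_le_sum fun τ _ => ?_
  rw [← sub_mul, mul_comm]
  have h := sum_reward_mem hr τ
  calc _ ≤ (∑ h : Fin H, r h (τ h).1) * |trajProb θ π τ - trajProb θ' π τ| :=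
        mul_le_mul_of_nonneg_left (le_abs_self _) h.1
    _ ≤ _ := mul_le_mul_of_nonneg_right h.2 (abs_nonneg _)

theorem optValue_le [Nonempty 𝒜] (θ : Params H 𝒮 𝒜 𝒪) {v : ℝ} (h : ∀ π, value r θ π ≤ v) :
    optValue r θ ≤ v := by
  have : Nonempty (Policy H 𝒜 𝒪) := ⟨mixture []⟩
  exact ciSup_le h

variable [Nonempty 𝒜]

theorem regret_one_le (θ : Params H 𝒮 𝒜 𝒪) (D : Data H 𝒜 𝒪) : regret r θ 1 D ≤ H := by
  have h1 : optValue r θ ≤ H := optValue_le hr θ fun π => (value_mem hr θ π).2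
  cases D with
  | nil => simp [regret]
  | cons d D =>
    have h2 := (value_mem hr θ d.1).1
    simp only [regret, List.take_succ_cons, List.take_zero, List.map_cons, List.map_nil,
      List.sum_singleton]
    linarith

/-- The regret bound on the event that the confidence sets contain the true model and only models
that predict the past well: by optimism, the regret is at most the sum of the errors of the chosen
models under the chosen policies. -/
theorem regret_le_of_confSet [DecidableEq 𝒮] {θ : Params H 𝒮 𝒜 𝒪} {α β B : ℝ} (hα : 0 < α)
    {alg : Data H 𝒜 𝒪 → Params H 𝒮 𝒜 𝒪 × Policy H 𝒜 𝒪} (halg : IsOMLE r α β alg) {K : ℕ}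
    {D : Data H 𝒜 𝒪} (hD : D ∈ (runLaw θ alg K).support)
    (hθ : ∀ k < K, θ ∈ (confSet α β (D.take k) : Set (Params H 𝒮 𝒜 𝒪))) (hB0 : 0 ≤ B)
    (hB : ∀ k < K, ∀ θ' ∈ (confSet α β (D.take k) : Set (Params H 𝒮 𝒜 𝒪)),
      ((D.take k).map fun d => trajDist θ' θ d.1 ^ 2).sum ≤ B) {k : ℕ} (hk : k ≤ K) :
    regret r θ k D ≤ H * ((1 + H * (Fintype.card 𝒪 * Fintype.card 𝒜 * Fintype.card 𝒮) +
      Fintype.card 𝒪) *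
        eluderBound (Fintype.card 𝒮) k (2 * (√(Fintype.card 𝒮) / α) + 1) B) := by
  have hopt := fun i (hi : i < K) => halg (D.take i) ⟨θ, hθ i hi⟩
  have hsum := sum_map_take_of_mem_support θ alg hD
  have hreg : regret r θ k D = ∑ i ∈ range k, (optValue r θ - value r θ (alg (D.take i)).2) :=
    hsum (fun π => optValue r θ - value r θ π) k hk
  have hmain := sum_trajDist_le θ (fun i => (alg (D.take i)).1) (fun i => (alg (D.take i)).2)
    (n := k) (B := B) hα (fun i hi => (hopt i (by omega)).1.1) hB0 fun i hi => by
      rw [← hsum (fun π => trajDist (alg (D.take i)).1 θ π ^ 2) i (by omega)]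
      exact hB i (by omega) _ (hopt i (by omega)).1
  rw [hreg]
  refine le_trans ?_ (mul_le_mul_of_nonneg_left hmain (Nat.cast_nonneg H))
  rw [Finset.mul_sum]
  refine Finset.sum_le_sum fun i hi => ?_
  have hi' : i < K := lt_of_lt_of_le (Finset.mem_range.1 hi) hk
  have h1 : optValue r θ ≤ value r (alg (D.take i)).1 (alg (D.take i)).2 :=
    optValue_le hr θ fun π => (hopt i hi').2 θ (hθ i hi') π
  have h2 := value_sub_value_le hr (alg (D.take i)).1 θ (alg (D.take i)).2
  linarith

end Regret

/-! ### The uniform mixture -/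

section Mix

variable {H : ℕ} {𝒮 𝒜 𝒪 : Type*} [Fintype 𝒜]

/-- The posterior weights of the mixture telescope: its weight is the average of the weights. -/
theorem length_mul_weight_mixture [Nonempty 𝒜] (L : List (Policy H 𝒜 𝒪)) {n : ℕ} (hn : n ≤ H)
    (τ : Traj n 𝒪 𝒜) :
    (L.length : ℝ) * (mixture L).weight hn τ = (L.map fun π => π.weight hn τ).sum := by
  induction n with
  | zero => simp [Policy.weight]
  | succ n ih =>
    obtain ⟨τ', x, rfl⟩ : ∃ (τ' : Traj n 𝒪 𝒜) (x : 𝒪 × 𝒜), τ = τ'.snoc x :=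
      ⟨fun i => τ i.castSucc, τ (Fin.last n),
        (Fin.snoc_init_self (α := fun _ => 𝒪 × 𝒜) τ).symm⟩
    have hn' : n ≤ H := (Nat.le_succ n).trans hn
    simp only [Policy.weight_snoc]
    rw [← mul_assoc, ih hn' τ']
    change _ * (if _ then _ else _) = _
    -- On a history of probability zero under all listed policies both sides vanish.
    split_ifs with h0
    · rw [h0, zero_mul]
      have hz : ∀ π ∈ L, π.weight hn' τ' = 0 := by
        intro π hπ
        have h1 := List.single_le_sum (l := L.map fun π => π.weight hn' τ')
          (fun y hy => by
            obtain ⟨π', _, rfl⟩ := List.mem_map.1 hy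
            exact π'.weight_nonneg _ _) _ (List.mem_map_of_mem hπ)
        exact le_antisymm (h1.trans h0.le) (π.weight_nonneg _ _)
      symm
      refine List.sum_eq_zero fun y hy => ?_
      obtain ⟨π, hπ, rfl⟩ := List.mem_map.1 hy
      rw [hz π hπ, zero_mul]
    · exact mul_div_cancel₀ _ h0

theorem length_mul_value_mixture [Fintype 𝒮] [Fintype 𝒪] [NeZero H] [Nonempty 𝒜]
    (r : Fin H → 𝒪 → ℝ) (θ : Params H 𝒮 𝒜 𝒪) (L : List (Policy H 𝒜 𝒪)) :
    (L.length : ℝ) * value r θ (mixture L) = (L.map fun π => value r θ π).sum := by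
  have key : ∀ (L : List (Policy H 𝒜 𝒪)) (g : Traj H 𝒪 𝒜 → ℝ),
      ∑ τ, (L.map fun π => π.weight le_rfl τ).sum * g τ =
        (L.map fun π => ∑ τ, π.weight le_rfl τ * g τ).sum := by
    intro L g
    induction L with
    | nil => simp
    | cons π L ih => simp [add_mul, Finset.sum_add_distrib, ih]
  simp only [value, trajProb, mul_assoc]
  rw [← key L, Finset.mul_sum]
  refine Finset.sum_congr rfl fun τ _ => ?_
  rw [← mul_assoc, length_mul_weight_mixture]

end Mix

/-! ### Constants and polynomials -/

/-- The confidence parameter dominates the logarithm of the squared size of the net, whose mesh is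
`1 / (H (S + O) K)`, times `(K / δ) ^ 2`. -/
theorem one_add_two_mul_log_le_omleBeta {S A O H K : ℕ} (hS : 1 ≤ S) (hA : 1 ≤ A) (hO : 1 ≤ O)
    (hH : 1 ≤ H) (hK : 2 ≤ K) {δ : ℝ} (hδ : 0 < δ)
    (hδ1 : δ ≤ 1) :
    1 + 2 * Real.log ((((H * (S + O) * K + 1) ^
      (S + (H - 1) * (A * S ^ 2) + H * (S * O)) : ℕ) : ℝ) * (K / δ)) ≤
      omleBeta 13 S A O H K δ := by
  set d := S + (H - 1) * (A * S ^ 2) + H * (S * O)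
  set q := S * A * O * H * K
  have hq2 : 2 ≤ q := by
    have : 1 * 1 * 1 * 1 * 2 ≤ S * A * O * H * K := by gcongr
    simpa using this
  have hm : H * (S + O) * K + 1 ≤ q ^ 3 := by
    have h1 : S + O ≤ 2 * (S * O) := by nlinarith
    have h2 : H * (S + O) * K ≤ 2 * q := by
      calc H * (S + O) * K ≤ H * (2 * (S * O)) * K := by gcongr
        _ = 2 * (S * 1 * O * H * K) := by ring
        _ ≤ 2 * (S * A * O * H * K) := by gcongr
    nlinarith [Nat.mul_le_mul hq2 hq2, Nat.mul_le_mul (Nat.mul_le_mul hq2 hq2) (le_refl q)]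
  have hd : (d : ℝ) ≤ 2 * (H * ((S : ℝ) ^ 2 * A + S * O)) := by
    have h1 : d ≤ 2 * (H * (S ^ 2 * A + S * O)) := by
      have h2 : S ≤ H * (S * O) := by
        calc S = 1 * (S * 1) := by ring
          _ ≤ H * (S * O) := by gcongr
      have h3 : (H - 1) * (A * S ^ 2) ≤ H * (A * S ^ 2) := by gcongr; omega
      have h4 : H * (A * S ^ 2) ≤ 2 * (H * (S ^ 2 * A)) := by
        nlinarith [Nat.zero_le (H * (A * S ^ 2))]
      calc d ≤ H * (S * O) + 2 * (H * (S ^ 2 * A)) + H * (S * O) := by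
            simp only [d]; omega
        _ = _ := by ring
    exact_mod_cast h1
  set Λ := Real.log ((S : ℝ) * A * O * H * K)
  have hΛq : Λ = Real.log q := by simp [Λ, q]
  have hq2' : (2 : ℝ) ≤ q := by exact_mod_cast hq2
  -- With at least two episodes the logarithm is bounded below, so that it absorbs constants.
  have hΛ : 1 / 2 ≤ Λ := by
    rw [hΛq]
    have h1 := Real.log_le_log (by norm_num) hq2'
    have h2 := Real.log_two_gt_d9
    linarith
  have hlogm : Real.log ((H * (S + O) * K + 1 : ℕ) : ℝ) ≤ 3 * Λ := by
    rw [hΛq]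
    have : ((H * (S + O) * K + 1 : ℕ) : ℝ) ≤ (q : ℝ) ^ 3 := by exact_mod_cast hm
    refine (Real.log_le_log (by positivity) this).trans_eq ?_
    rw [Real.log_pow]
    norm_num
  have hM : 2 ≤ (H : ℝ) * ((S : ℝ) ^ 2 * A + S * O) := by
    have : 1 * (1 ^ 2 * 1 + 1 * 1) ≤ H * (S ^ 2 * A + S * O) := by gcongr
    exact_mod_cast this
  have hK' : (0 : ℝ) < K := by exact_mod_cast (by omega : 0 < K)
  have hlogm0 : 0 ≤ Real.log ((H * (S + O) * K + 1 : ℕ) : ℝ) :=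
    Real.log_nonneg (by exact_mod_cast Nat.succ_le_succ (Nat.zero_le _))
  rw [Real.log_mul (by positivity) (by positivity), Nat.cast_pow, Real.log_pow, omleBeta]
  have hι : 0 ≤ Real.log (K / δ) := by
    refine Real.log_nonneg ?_
    rw [le_div_iff₀ hδ]
    have : (2 : ℝ) ≤ K := by exact_mod_cast hK
    linarith
  set M := (H : ℝ) * ((S : ℝ) ^ 2 * A + S * O)
  have h5 : (d : ℝ) * Real.log ((H * (S + O) * K + 1 : ℕ) : ℝ) ≤ (2 * M) * (3 * Λ) :=
    mul_le_mul hd hlogm hlogm0 (by linarith)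
  have h6 : 1 ≤ M * Λ := by nlinarith
  linarith

/-- The regret bound for one value of the problem parameters, in terms of a common upper bound `P`
of all of them. -/
theorem regret_bound_le {S A O H K k : ℕ} (hA : 1 ≤ A) (hk1 : 1 ≤ k) (hkK : k ≤ K)
    (hS : 1 ≤ S) (hO : 1 ≤ O) (hH : 1 ≤ H)
    {α δ P : ℝ} (hα : 0 < α) (hδ : 0 < δ) (hδ1 : δ ≤ 1) (hSP : (S : ℝ) ≤ P) (hAP : (A : ℝ) ≤ P)
    (hOP : (O : ℝ) ≤ P) (hHP : (H : ℝ) ≤ P) (hSαP : S * (1 / α) ≤ P)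
    (hιP : 1 + Real.log (K / δ) ≤ P) :
    0 ≤ omleBeta 13 S A O H K δ ∧
    H * ((1 + H * (O * A * S) + O) * eluderBound S k (2 * (√S / α) + 1)
      (32 + 16 * omleBeta 13 S A O H K δ)) ≤ 600 * P ^ 12 * √k := by
  have hS' : (1 : ℝ) ≤ S := by exact_mod_cast hS
  have hA' : (1 : ℝ) ≤ A := by exact_mod_cast hA
  have hO' : (1 : ℝ) ≤ O := by exact_mod_cast hO
  have hH' : (1 : ℝ) ≤ H := by exact_mod_cast hH
  have hk' : (1 : ℝ) ≤ k := by exact_mod_cast hk1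
  have hkK' : (k : ℝ) ≤ K := by exact_mod_cast hkK
  have hK' : (1 : ℝ) ≤ K := hk'.trans hkK'
  have hP : 1 ≤ P := hS'.trans hSP
  have hι : Real.log K ≤ Real.log (K / δ) :=
    Real.log_le_log (by linarith) (by rw [le_div_iff₀ hδ]; nlinarith)
  have hι0 : 0 ≤ Real.log K := Real.log_nonneg hK'
  have hpow : ∀ a b : ℕ, a ≤ b → P ^ a ≤ P ^ b := fun a b h => pow_le_pow_right₀ hP h
  have hΛ0 : 0 ≤ Real.log ((S : ℝ) * A * O * H * K) := by
    refine Real.log_nonneg ?_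
    have : 1 * 1 * 1 * 1 * 1 ≤ (S : ℝ) * A * O * H * K := by gcongr
    simpa using this
  have hΛ : Real.log ((S : ℝ) * A * O * H * K) ≤ 2 * P ^ 4 := by
    rw [Real.log_mul (by positivity) (by positivity)]
    have h1 : Real.log ((S : ℝ) * A * O * H) ≤ P ^ 4 := by
      refine (Real.log_le_self (by positivity)).trans ?_
      calc (S : ℝ) * A * O * H ≤ P * P * P * P := by gcongr
        _ = P ^ 4 := by ring
    have h2 := hpow 1 4 (by norm_num)
    rw [pow_one] at h2
    linarith
  have hM : (H : ℝ) * ((S : ℝ) ^ 2 * A + S * O) ≤ 2 * P ^ 4 := by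
    calc (H : ℝ) * ((S : ℝ) ^ 2 * A + S * O) ≤ P * (P ^ 2 * P + P * P) := by gcongr
      _ = P ^ 4 + P ^ 3 := by ring
      _ ≤ _ := by linarith [hpow 3 4 (by norm_num)]
  have hβ0 : 0 ≤ omleBeta 13 S A O H K δ := by
    rw [omleBeta]
    have : 0 ≤ Real.log (K / δ) := hι0.trans hι
    positivity
  refine ⟨hβ0, ?_⟩
  have hβ : omleBeta 13 S A O H K δ ≤ 65 * P ^ 8 := by
    rw [omleBeta]
    have h1 : (H : ℝ) * ((S : ℝ) ^ 2 * A + S * O) * Real.log ((S : ℝ) * A * O * H * K) ≤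
        (2 * P ^ 4) * (2 * P ^ 4) := mul_le_mul hM hΛ hΛ0 (by positivity)
    have h2 := hpow 1 8 (by norm_num)
    rw [pow_one] at h2
    nlinarith
  have hB : 32 + 16 * omleBeta 13 S A O H K δ ≤ 1100 * P ^ 8 := by
    have := one_le_pow₀ hP (n := 8)
    linarith
  set B := 32 + 16 * omleBeta 13 S A O H K δ
  have hB0 : 0 ≤ B := by positivity
  have hR : 2 * (√S / α) + 1 ≤ 3 * P := by
    have h1 : √(S : ℝ) ≤ S := by
      rw [Real.sqrt_le_left (by linarith)]
      nlinarith
    have h2 : √S / α ≤ S * (1 / α) := by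
      rw [mul_one_div]
      gcongr
    linarith
  set R := 2 * (√S / α) + 1
  have hR0 : 0 ≤ R := by positivity
  have hlog : Real.log (1 + k) ≤ P := by
    have h1 : Real.log (1 + k) ≤ Real.log (2 * K) := Real.log_le_log (by linarith) (by linarith)
    rw [Real.log_mul (by norm_num) (by linarith)] at h1
    have h2 := Real.log_two_lt_d9
    linarith
  have hlog0 : 0 ≤ Real.log (1 + k) := Real.log_nonneg (by linarith)
  have hsqrt : √(k * (2 * (S * R ^ 2 + R ^ 2 * B + R ^ 2) *
      ((S : ℝ) ^ 2 + S * Real.log (1 + k)))) ≤ 200 * P ^ 6 * √k := by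
    rw [Real.sqrt_le_left (by positivity), mul_pow, Real.sq_sqrt (by positivity), mul_comm]
    refine mul_le_mul_of_nonneg_right ?_ (by positivity)
    have h1 : S * R ^ 2 + R ^ 2 * B + R ^ 2 ≤ 10000 * P ^ 10 := by
      calc S * R ^ 2 + R ^ 2 * B + R ^ 2
          ≤ P * (3 * P) ^ 2 + (3 * P) ^ 2 * (1100 * P ^ 8) + (3 * P) ^ 2 := by gcongr
        _ = 9 * P ^ 3 + 9900 * P ^ 10 + 9 * P ^ 2 := by ring
        _ ≤ _ := by linarith [hpow 3 10 (by norm_num), hpow 2 10 (by norm_num),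
              one_le_pow₀ hP (n := 10)]
    have h2 : (S : ℝ) ^ 2 + S * Real.log (1 + k) ≤ 2 * P ^ 2 := by
      calc (S : ℝ) ^ 2 + S * Real.log (1 + k) ≤ P ^ 2 + P * P := by gcongr
        _ = _ := by ring
    calc 2 * (S * R ^ 2 + R ^ 2 * B + R ^ 2) * ((S : ℝ) ^ 2 + S * Real.log (1 + k))
        ≤ 2 * (10000 * P ^ 10) * (2 * P ^ 2) := by gcongr
      _ = (200 * P ^ 6) ^ 2 := by ring
  have hE : eluderBound S k R B ≤ 200 * P ^ 7 * √k := by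
    rw [eluderBound]
    calc _ ≤ P * (200 * P ^ 6 * √k) := by gcongr
      _ = _ := by ring
  have hE0 : 0 ≤ eluderBound S k R B := by rw [eluderBound]; positivity
  have hpre : 1 + (H : ℝ) * (O * A * S) + O ≤ 3 * P ^ 4 := by
    calc 1 + (H : ℝ) * (O * A * S) + O ≤ 1 + P * (P * P * P) + P := by gcongr
      _ = 1 + P ^ 4 + P ^ 1 := by ring
      _ ≤ _ := by linarith [hpow 1 4 (by norm_num), one_le_pow₀ hP (n := 4)]
  calc _ ≤ P * (3 * P ^ 4 * (200 * P ^ 7 * √k)) := by gcongr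
    _ = _ := by ring

/-- Powers of `1 + log x` grow more slowly than any root of `x`. -/
theorem one_add_log_pow_le {x : ℝ} (hx : 1 ≤ x) :
    (1 + Real.log x) ^ 12 ≤ 49 ^ 12 * x ^ (1 / 4 : ℝ) := by
  have h1 : Real.log x ≤ x ^ (1 / 48 : ℝ) / (1 / 48) :=
    Real.log_le_rpow_div (by linarith) (by norm_num)
  have h2 : 1 ≤ x ^ (1 / 48 : ℝ) := Real.one_le_rpow hx (by norm_num)
  have h3 : 0 ≤ Real.log x := Real.log_nonneg hx
  calc (1 + Real.log x) ^ 12 ≤ (49 * x ^ (1 / 48 : ℝ)) ^ 12 := by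
        gcongr
        linarith
    _ = 49 ^ 12 * x ^ (1 / 4 : ℝ) := by
        rw [mul_pow, ← Real.rpow_mul_natCast (by linarith)]
        norm_num

/-- The polynomial of the regret bound. -/
noncomputable def regretPoly : MvPolynomial (Fin 6) ℝ :=
  MvPolynomial.C 600 * ((1 + MvPolynomial.X 0) * (1 + MvPolynomial.X 1) * (1 + MvPolynomial.X 2) *
    (1 + MvPolynomial.X 3) * (1 + MvPolynomial.X 4) * (1 + MvPolynomial.X 5)) ^ 12

/-- The polynomial of the sample complexity bound. The factor `49 ^ 12` and the fourth power come
from `(1 + log K) ^ 12 ≤ 49 ^ 12 * K ^ (1 / 4)`. -/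
noncomputable def samplePoly : MvPolynomial (Fin 7) ℝ :=
  (MvPolynomial.C (600 * 49 ^ 12) * ((1 + MvPolynomial.X 0) * (1 + MvPolynomial.X 1) *
    (1 + MvPolynomial.X 2) * (1 + MvPolynomial.X 3) * (1 + MvPolynomial.X 4) *
    (1 + MvPolynomial.X 5)) ^ 12 * MvPolynomial.X 6) ^ 4

theorem eval_regretPoly (a b c d e f : ℝ) : MvPolynomial.eval ![a, b, c, d, e, f] regretPoly =
    600 * ((1 + a) * (1 + b) * (1 + c) * (1 + d) * (1 + e) * (1 + f)) ^ 12 := by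
  simp [regretPoly]

theorem eval_samplePoly (a b c d e f g : ℝ) :
    MvPolynomial.eval ![a, b, c, d, e, f, g] samplePoly =
      (600 * 49 ^ 12 * ((1 + a) * (1 + b) * (1 + c) * (1 + d) * (1 + e) * (1 + f)) ^ 12 *
        g) ^ 4 := by
  simp [samplePoly]

/-- The arithmetic behind the sample complexity, with `K = y⁴`. -/
theorem mul_pow_mul_sq_le {c M Q L X x y ε : ℝ} (hc : 0 ≤ c) (hQ : 0 ≤ Q)
    (hX : 0 ≤ X) (hy : 0 ≤ y) (hε : 0 < ε)
    (h : (c * M * (Q * L) ^ 12 * (1 / ε)) ^ 4 ≤ y ^ 4)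
    (hx : x ^ 12 ≤ M * y) (hXL : X ≤ L * x) : c * (Q * X) ^ 12 * y ^ 2 ≤ ε * y ^ 4 := by
  have h1 : c * M * (Q * L) ^ 12 * (1 / ε) ≤ y := le_of_pow_le_pow_left₀ (by norm_num) hy h
  rw [mul_one_div, div_le_iff₀ hε] at h1
  have h2 : (Q * X) ^ 12 ≤ (Q * L) ^ 12 * (M * y) := by
    calc (Q * X) ^ 12 ≤ (Q * (L * x)) ^ 12 := by gcongr
      _ = (Q * L) ^ 12 * x ^ 12 := by rw [← mul_assoc, mul_pow]
      _ ≤ _ := mul_le_mul_of_nonneg_left hx (by positivity)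
  generalize (Q * L) ^ 12 = u at h1 h2
  generalize (Q * X) ^ 12 = v at h2 ⊢
  calc c * v * y ^ 2 ≤ c * (u * (M * y)) * y ^ 2 := by gcongr
    _ = (c * M * u) * y ^ 3 := by ring
    _ ≤ (y * ε) * y ^ 3 := mul_le_mul_of_nonneg_right h1 (by positivity)
    _ = ε * y ^ 4 := by ring

/-- Once `K` exceeds the sample complexity, the regret bound is at most `ε K`. -/
theorem regretPoly_mul_sqrt_le {a b c d e : ℝ} (ha : 0 ≤ a) (hb : 0 ≤ b) (hc : 0 ≤ c) (hd : 0 ≤ d)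
    (he : 0 ≤ e) {δ ε : ℝ} (hδ : 0 < δ) (hδ1 : δ ≤ 1) (hε : 0 < ε) {K : ℕ} (hK : 1 ≤ K)
    (h : MvPolynomial.eval ![a, b, c, d, e, Real.log (1 / δ), 1 / ε] samplePoly ≤ K) :
    MvPolynomial.eval ![a, b, c, d, e, Real.log (K / δ)] regretPoly * √(K : ℝ) ≤ ε * K := by
  have hK' : (1 : ℝ) ≤ K := by exact_mod_cast hK
  have hK0 : (0 : ℝ) ≤ K := by linarith
  have hℓ : 0 ≤ Real.log (1 / δ) := Real.log_nonneg (by rw [le_div_iff₀ hδ]; linarith)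
  have hlogK : 0 ≤ Real.log K := Real.log_nonneg hK'
  have hlog : Real.log (K / δ) = Real.log K + Real.log (1 / δ) := by
    rw [div_eq_mul_one_div, Real.log_mul (by positivity) (by positivity)]
  have hpow := one_add_log_pow_le hK'
  obtain ⟨y, hy⟩ : ∃ y, y = (K : ℝ) ^ (1 / 4 : ℝ) := ⟨_, rfl⟩
  rw [← hy] at hpow
  have hy0 : 0 ≤ y := by rw [hy]; positivity
  have hy4 : (K : ℝ) = y ^ 4 := by
    rw [hy, ← Real.rpow_mul_natCast hK0]
    norm_num
  have hsq : √(K : ℝ) = y ^ 2 := by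
    rw [hy4, show y ^ 4 = (y ^ 2) ^ 2 by ring, Real.sqrt_sq (by positivity)]
  have hXL : 1 + Real.log (K / δ) ≤ (1 + Real.log (1 / δ)) * (1 + Real.log K) := by
    rw [hlog]
    nlinarith
  have hX : 0 ≤ 1 + Real.log (K / δ) := by
    rw [hlog]
    positivity
  have hQ : 0 ≤ (1 + a) * (1 + b) * (1 + c) * (1 + d) * (1 + e) := by positivity
  rw [eval_samplePoly] at h
  rw [eval_regretPoly]
  rw [hsq]
  refine (mul_pow_mul_sq_le (M := 49 ^ 12) (by norm_num) hQ hX hy0 hε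
    (h.trans_eq hy4) hpow hXL).trans_eq ?_
  rw [← hy4]

/-! ### Regret and sample complexity of OMLE -/

/-- All problem parameters are bounded by the product of their successors. -/
theorem le_prod_one_add {s a o h x t : ℝ} (hs : 0 ≤ s) (ha : 0 ≤ a) (ho : 0 ≤ o) (hh : 0 ≤ h)
    (hx : 0 ≤ x) (ht : 0 ≤ t) {P : ℝ}
    (hP : P = (1 + s) * (1 + a) * (1 + o) * (1 + h) * (1 + x) * (1 + t)) :
    s ≤ P ∧ a ≤ P ∧ o ≤ P ∧ h ≤ P ∧ s * x ≤ P ∧ 1 + t ≤ P := by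
  have hmono : ∀ {a' b' c' d' e' f' : ℝ}, 0 ≤ a' → 0 ≤ b' → 0 ≤ c' → 0 ≤ d' → 0 ≤ e' → 0 ≤ f' →
      a' ≤ 1 + s → b' ≤ 1 + a → c' ≤ 1 + o → d' ≤ 1 + h → e' ≤ 1 + x → f' ≤ 1 + t →
      a' * b' * c' * d' * e' * f' ≤ P := by
    intro a' b' c' d' e' f' _ _ _ _ _ _ h1 h2 h3 h4 h5 h6
    rw [hP]
    gcongr
  have up : ∀ {y : ℝ}, 0 ≤ y → 1 ≤ 1 + y := fun h => le_add_of_nonneg_right h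
  have up' : ∀ {y : ℝ}, y ≤ 1 + y := fun {y} => le_add_of_nonneg_left zero_le_one
  have z : (0 : ℝ) ≤ 1 := zero_le_one
  refine ⟨?_, ?_, ?_, ?_, ?_, ?_⟩
  · simpa using hmono hs z z z z z up' (up ha) (up ho) (up hh) (up hx) (up ht)
  · simpa using hmono z ha z z z z (up hs) up' (up ho) (up hh) (up hx) (up ht)
  · simpa using hmono z z ho z z z (up hs) (up ha) up' (up hh) (up hx) (up ht)
  · simpa using hmono z z z hh z z (up hs) (up ha) (up ho) up' (up hx) (up ht)
  · simpa using hmono hs z z z hx z up' (up ha) (up ho) (up hh) up' (up ht)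
  · simpa using hmono z z z z z (z.trans (up ht)) (up hs) (up ha) (up ho) (up hh) (up hx) le_rfl

/-- With probability at least `1 - δ` the regret bound holds along the whole run; the event is
stated inside the almost sure event that `K` episodes are recorded. -/
theorem le_toOuterMeasure_regret {𝒮 𝒜 𝒪 : Type*} [Fintype 𝒮] [DecidableEq 𝒮] [Fintype 𝒜]
    [Nonempty 𝒜] [Fintype 𝒪] {H : ℕ} [NeZero H] {r : Fin H → 𝒪 → ℝ}
    (hr : ∀ h o, r h o ∈ Set.Icc (0 : ℝ) 1) {θ : Params H 𝒮 𝒜 𝒪} {α : ℝ} (hα : 0 < α)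
    (hθ : WeaklyRevealing α θ) {δ : ℝ} (hδ : 0 < δ) (hδ1 : δ ≤ 1) {K : ℕ} (hK : 1 ≤ K)
    {alg : Data H 𝒜 𝒪 → Params H 𝒮 𝒜 𝒪 × Policy H 𝒜 𝒪}
    (halg : IsOMLE r α (omleBeta 13 (Fintype.card 𝒮) (Fintype.card 𝒜) (Fintype.card 𝒪) H K δ) alg) :
    ENNReal.ofReal (1 - δ) ≤ (runLaw θ alg K).toOuterMeasure
      {D | D.length = K ∧ ∀ k ∈ Finset.Icc 1 K, regret r θ k D ≤
        MvPolynomial.eval ![(Fintype.card 𝒮 : ℝ), (Fintype.card 𝒜 : ℝ), (Fintype.card 𝒪 : ℝ),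
          (H : ℝ), 1 / α, Real.log (K / δ)] regretPoly * √(k : ℝ)} := by
  have hne𝒮 : Nonempty 𝒮 := by
    by_contra h
    rw [not_nonempty_iff] at h
    simpa using θ.init_mem.2
  have hne𝒪 : Nonempty 𝒪 := by
    by_contra h
    rw [not_nonempty_iff] at h
    simpa using (θ.emis_mem 0 (Classical.arbitrary 𝒮)).2
  have hH : 1 ≤ H := Nat.one_le_iff_ne_zero.2 (NeZero.ne H)
  have hS : 1 ≤ Fintype.card 𝒮 := Fintype.card_pos
  have hA : 1 ≤ Fintype.card 𝒜 := Fintype.card_pos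
  have hO : 1 ≤ Fintype.card 𝒪 := Fintype.card_pos
  have hK' : (1 : ℝ) ≤ K := by exact_mod_cast hK
  have hι : 0 ≤ Real.log (K / δ) := Real.log_nonneg (by rw [le_div_iff₀ hδ]; linarith)
  set β := omleBeta 13 (Fintype.card 𝒮) (Fintype.card 𝒜) (Fintype.card 𝒪) H K δ
  rw [eval_regretPoly]
  set S := Fintype.card 𝒮
  set A := Fintype.card 𝒜
  set O := Fintype.card 𝒪
  obtain ⟨P, hP⟩ : ∃ P, P = (1 + (S : ℝ)) * (1 + A) * (1 + O) * (1 + H) * (1 + 1 / α) *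
    (1 + Real.log (K / δ)) := ⟨_, rfl⟩
  rw [← hP]
  obtain ⟨pS, pA, pO, pH, pSα, pι⟩ := le_prod_one_add (Nat.cast_nonneg S) (Nat.cast_nonneg A)
    (Nat.cast_nonneg O) (Nat.cast_nonneg H) (by positivity) hι hP
  have hP1 : 1 ≤ P := le_trans (le_add_of_nonneg_right hι) pι
  clear hP
  rcases hK.eq_or_lt with rfl | hK2
  · -- With one episode the regret is at most `H`, whatever policy is executed.
    have hone : (runLaw θ alg 1).toOuterMeasure {D | D.length = 1 ∧ ∀ k ∈ Finset.Icc 1 1,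
        regret r θ k D ≤ 600 * P ^ 12 * √(k : ℝ)} = 1 := by
      rw [PMF.toOuterMeasure_apply_eq_one_iff]
      refine fun D hD => ⟨length_of_mem_support θ alg hD, fun k hk => ?_⟩
      obtain rfl : k = 1 := by simpa using hk
      refine (regret_one_le hr θ D).trans ?_
      have : P ^ 1 ≤ P ^ 12 := pow_le_pow_right₀ hP1 (by norm_num)
      rw [Nat.cast_one, Real.sqrt_one]
      linarith
    rw [hone]
    exact ENNReal.ofReal_le_one.2 (by linarith)
  -- With this mesh the net dominates all models up to the factor `exp (1 / K)`, that is, up to a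
  -- constant factor for the likelihood of all the data.
  have hm : 0 < H * (S + O) * K := by positivity
  have : Nonempty (Params H 𝒮 𝒜 𝒪) := ⟨θ⟩
  obtain ⟨net, hnet⟩ := exists_net (H := H) (𝒮 := 𝒮) (𝒜 := 𝒜) (𝒪 := 𝒪) hm
  have hexp : (H * (Fintype.card 𝒮 + Fintype.card 𝒪) / (H * (S + O) * K : ℕ) : ℝ) = 1 / K := by
    have h1 : (H : ℝ) * (S + O) ≠ 0 := by positivity
    push_cast
    change (H : ℝ) * (S + O) / (H * (S + O) * K) = 1 / K
    field_simp
  rw [hexp] at hnet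
  refine le_toOuterMeasure_of_prod_hellingerRatio_le θ alg (by positivity) hK net hδ
    fun D hD hgood => ⟨length_of_mem_support θ alg hD, fun k hk => ?_⟩
  obtain ⟨hk1, hkK⟩ := Finset.mem_Icc.1 hk
  have hβ := one_add_two_mul_log_le_omleBeta hS hA hO hH hK2 hδ hδ1
  have hC : (0 : ℝ) < (((H * (S + O) * K + 1) ^
      (S + (H - 1) * (A * S ^ 2) + H * (S * O)) : ℕ) : ℝ) * (K / δ) := by positivity
  have hpos := trajProb_pos_of_mem_support θ alg hD
  have hlen : ∀ j, (D.take j).length ≤ K := fun j => by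
    rw [List.length_take, length_of_mem_support θ alg hD]
    exact min_le_right _ _
  have hpos' : ∀ j, ∀ d ∈ D.take j, 0 < trajProb θ d.1 d.2 := fun j d hd =>
    hpos d (List.mem_of_mem_take hd)
  obtain ⟨hβ0, hbound⟩ := regret_bound_le hA hk1 hkK hS hO hH hα hδ hδ1 pS pA pO pH pSα pι
  refine (regret_le_of_confSet hr hα halg hD (B := 32 + 16 * β) (fun j hj => ?_) (by positivity)
    (fun j hj θ' hθ' => ?_) hkK).trans hbound
  · rw [mem_confSet_iff]
    exact ⟨hθ, fun θ' => lik_le_exp_mul_lik hK (hlen j) (hpos' j) hnet hC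
      (fun c => hgood c j hj) hβ θ'⟩
  · rw [mem_confSet_iff] at hθ'
    exact sum_trajDist_sq_le_of_lik_le hK (hlen j) (hpos' j) hnet hC
      (fun c => hgood c j hj) hβ (hθ'.2 θ)

/-- The average regret is the suboptimality of the uniform mixture. -/
theorem optValue_sub_le_value_mixture {𝒮 𝒜 𝒪 : Type*} [Fintype 𝒮] [Fintype 𝒜] [Nonempty 𝒜]
    [Fintype 𝒪] {H : ℕ} [NeZero H] (r : Fin H → 𝒪 → ℝ) (θ : Params H 𝒮 𝒜 𝒪) {K : ℕ} (hK : 1 ≤ K)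
    {D : Data H 𝒜 𝒪} (hD : D.length = K) {ε : ℝ} (h : regret r θ K D ≤ ε * K) :
    optValue r θ - ε ≤ value r θ (mixture (D.map Prod.fst)) := by
  have h1 := length_mul_value_mixture r θ (D.map Prod.fst)
  have h2 : ∀ E : Data H 𝒜 𝒪, (E.map fun d => optValue r θ - value r θ d.1).sum =
      E.length * optValue r θ - ((E.map Prod.fst).map fun π => value r θ π).sum := by
    intro E
    induction E with
    | nil => simp
    | cons d E ih =>
      simp only [List.map_cons, List.sum_cons, List.length_cons, Nat.cast_succ, ih]
      ring
  rw [regret, List.take_of_length_le hD.le, h2, ← h1, List.length_map, hD] at h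
  have hK' : (0 : ℝ) < K := by exact_mod_cast hK
  nlinarith

end POMDP

theorem mainTheorem1 :
    ∃ c : ℝ, 0 < c ∧ ∃ (p : MvPolynomial (Fin 6) ℝ) (q : MvPolynomial (Fin 7) ℝ),
      ∀ (𝒮 𝒜 𝒪 : Type*) [Fintype 𝒮] [DecidableEq 𝒮] [Fintype 𝒜] [Nonempty 𝒜] [Fintype 𝒪]
        (H : ℕ) [NeZero H] (r : Fin H → 𝒪 → ℝ), (∀ h o, r h o ∈ Set.Icc (0 : ℝ) 1) →
      ∀ (θ : POMDP.Params H 𝒮 𝒜 𝒪) (α : ℝ), 0 < α → POMDP.WeaklyRevealing α θ →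
      ∀ δ : ℝ, 0 < δ → δ ≤ 1 → ∀ K : ℕ, 1 ≤ K →
      ∀ alg : POMDP.Data H 𝒜 𝒪 → POMDP.Params H 𝒮 𝒜 𝒪 × POMDP.Policy H 𝒜 𝒪,
        POMDP.IsOMLE r α (POMDP.omleBeta c (Fintype.card 𝒮) (Fintype.card 𝒜) (Fintype.card 𝒪) H K δ)
          alg →
        -- regret bound, simultaneously for all `k ≤ K`
        ENNReal.ofReal (1 - δ) ≤ (POMDP.runLaw θ alg K).toOuterMeasure
          {D | ∀ k ∈ Finset.Icc 1 K, POMDP.regret r θ k D ≤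
            MvPolynomial.eval ![(Fintype.card 𝒮 : ℝ), (Fintype.card 𝒜 : ℝ), (Fintype.card 𝒪 : ℝ),
              (H : ℝ), 1 / α, Real.log (K / δ)] p * √(k : ℝ)} ∧
        -- polynomial sample complexity of learning an `ε`-optimal policy
        ∀ ε : ℝ, 0 < ε →
          MvPolynomial.eval ![(Fintype.card 𝒮 : ℝ), (Fintype.card 𝒜 : ℝ), (Fintype.card 𝒪 : ℝ),
            (H : ℝ), 1 / α, Real.log (1 / δ), 1 / ε] q ≤ (K : ℝ) →
          ENNReal.ofReal (1 - δ) ≤ (POMDP.runLaw θ alg K).toOuterMeasure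
            {D | POMDP.optValue r θ - ε ≤ POMDP.value r θ (POMDP.mixture (D.map Prod.fst))} := by
  refine ⟨13, by norm_num, POMDP.regretPoly, POMDP.samplePoly, ?_⟩
  intro 𝒮 𝒜 𝒪 _ _ _ _ _ H _ r hr θ α hα hθ δ hδ hδ1 K hK alg halg
  have hmain := POMDP.le_toOuterMeasure_regret hr hα hθ hδ hδ1 hK halg
  refine ⟨hmain.trans (MeasureTheory.OuterMeasure.mono _ fun D hD => hD.2), fun ε hε hq => ?_⟩
  refine hmain.trans (MeasureTheory.OuterMeasure.mono _ fun D hD => ?_)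
  refine POMDP.optValue_sub_le_value_mixture r θ hK hD.1
    ((hD.2 K (Finset.mem_Icc.2 ⟨hK, le_rfl⟩)).trans ?_)
  exact POMDP.regretPoly_mul_sqrt_le (Nat.cast_nonneg _) (Nat.cast_nonneg _) (Nat.cast_nonneg _)
    (Nat.cast_nonneg _) (by positivity) hδ hδ1 hε hK hq
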